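/- A finite groupoid is a groupoid with finitely many objects and finitely many morphisms. Consider the following two bicategories whose objects are all finite groupoids. $\mathrm{Span}^{\mathrm{rf}}$: a 1-cell $H\to G$ is a right-faithful span $H \xleftarrow{u} P \xrightarrow{i} G$, where $P$ is a finite groupoid, $u$ a functor and $i$ a faithful functor. A 2-cell from $(P,u,i)$ to $(Q,v,j)$ is an isomorphism class $[p,\alpha,\beta]$ of triples consisting of a functor $p\colon P\to Q$ and natural isomorphisms $\alpha\colon u\Rightarrow vp$ and $\beta\colon jp\Rightarrow i$; an isomorphism $(p,\alpha,\beta)\cong(p',\alpha',\beta')$ is a natural isomorphism $p\cong p'$ compatible with $\alpha,\alpha'$ and with $\beta,\beta'$. 1-cells $K \leftarrow P \to H$ and $H\leftarrow Q\to G$ are composed through the iso-comma groupoid of $P\to H\leftarrow Q$, whose objects are the triples $(p,q,\theta)$ with $\theta$ an isomorphism in $H$ from the image of $p$ to the image of $q$. $\mathrm{biset}^{\mathrm{rf}}$: a 1-cell $H\to G$ is a right-free finite biset, i.e. a functor $S\colon H^{\mathrm{op}}\times G\to\mathrm{Set}$ with finite values such that $s\cdot h=s$ implies $h=\mathrm{id}_y$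 for all $s\in S(y,x)$ and $h\in H(y,y)$. 2-cells are natural transformations (equivariant maps). The composite of $S\colon K\to H$ and $T\colon H\to G$ is the tensor product $T\times_H S$, whose elements at $(z,x)$ are the classes $[t,s]$ of pairs with $t\in T(y,x)$, $s\in S(z,y)$, $y\in H$, modulo $[t\cdot h,s]=[t,h\cdot s]$; the identity 1-cell of $G$ is $G(-,-)$. Then there is a biequivalence $$\mathcal R\colon \mathrm{Span}^{\mathrm{rf}}\ \rightleftarrows\ \mathrm{biset}^{\mathrm{rf}}\ \colon\!\textstyle\int$$ given by the following two pseudo-functors, both of which are the identity on objects. (a) The realization $\mathcal R$ sends a span $H\xleftarrow{u}P\xrightarrow{i}G$ to the biset $G(i-,-)\times_P H(-,u-)$ and a 2-cell $[p,\alpha,\beta]$ to the map $[g,h]_z\mapsto [g\beta_z,\alpha_z h]_{p(z)}$. Its structure isomorphisms are $[g,h]\mapsto gh$ for an identity span and $[g,h]_{(p,q,\theta)}\mapsto[[g,\theta]_q,[\mathrm{id},h]_p]$ for a composite span. (b) The Grothendieck construction $\int$ sends a biset $S\colon H^{\mathrm{op}}\times G\to\mathrm{Set}$ to the span $H\leftarrow\int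 S\to G$ of projections, where the objects of $\int S$ are the triples $(y,x,s)$ with $s\in S(y,x)$, and the morphisms $(y,x,s)\to(y',x',s')$ are the pairs $(h,g)\in H(y,y')\times G(x,x')$ with $g\cdot s=s'\cdot h$; it sends an equivariant map $\varphi$ to $[\int\varphi,\mathrm{id},\mathrm{id}]$. Its structure 2-cells, which are invertible, are those given by $x\mapsto(x,x,\mathrm{id}_x)$, from the identity span of $G$ to $\int G(-,-)$, and by $((z,y,s),(y',x,t),\theta\colon y\to y')\mapsto(z,x,[t\cdot\theta,s])$, from the composite of $\int S$ and $\int T$ to $\int(T\times_H S)$. These pseudo-functors are mutually quasi-inverse: $\int\circ\mathcal R$ is equivalent to the identity pseudo-functor of $\mathrm{Span}^{\mathrm{rf}}$, and $\mathcal R\circ\int$ to the identity pseudo-functor of $\mathrm{biset}^{\mathrm{rf}}$, in the bicategories of pseudo-functors, pseudo-natural transformations and modifications. -/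

import Mathlib

open CategoryTheory

set_option linter.unusedVariables false

universe u

/-- A finite groupoid: finitely many objects and finitely many morphisms, all of them invertible. -/
structure FinGpd : Type (u + 1) where
  carrier : Type u
  [grpd : Groupoid.{u} carrier]
  [finiteObj : Finite carrier]
  [finiteHom : ∀ x y : carrier, Finite (x ⟶ y)]

namespace FinGpd

instance : CoeSort FinGpd.{u} (Type u) := ⟨FinGpd.carrier⟩

attribute [instance] FinGpd.grpd FinGpd.finiteObj FinGpd.finiteHom

end FinGpd

/-- A right-faithful span `H ← P → G` of finite groupoids: a functor `l : P ⥤ H` and a faithful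
functor `r : P ⥤ G`. It is a 1-cell from `H` to `G`. -/
structure RfSpan (H G : FinGpd.{u}) : Type (u + 1) where
  apex : FinGpd.{u}
  l : apex ⥤ H
  r : apex ⥤ G
  faithful : r.Faithful

/-- A triple `(p, α, β)` from the span `X` to the span `Y`: a functor `p` between the apexes and
natural transformations `α` from `X.l` to `p ⋙ Y.l` and `β` from `p ⋙ Y.r` to `X.r`
(automatically invertible, as their targets are groupoids). -/
structure SpanTriple {H G : FinGpd.{u}} (X Y : RfSpan H G) : Type u where
  p : X.apex ⥤ Y.apex
  α : ∀ z, X.l.obj z ⟶ Y.l.obj (p.obj z)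
  α_nat : ∀ {z w} (f : z ⟶ w), X.l.map f ≫ α w = α z ≫ Y.l.map (p.map f)
  β : ∀ z, Y.r.obj (p.obj z) ⟶ X.r.obj z
  β_nat : ∀ {z w} (f : z ⟶ w), Y.r.map (p.map f) ≫ β w = β z ≫ X.r.map f

namespace SpanTriple

variable {H G : FinGpd.{u}} {X Y Z : RfSpan H G}

/-- An isomorphism of triples `(p, α, β) ≅ (p', α', β')` is a natural isomorphism `p ≅ p'`
compatible with `α, α'` and with `β, β'`. -/
def Rel (s t : SpanTriple X Y) : Prop :=
  ∃ c : s.p ≅ t.p, (∀ z, s.α z ≫ Y.l.map (c.hom.app z) = t.α z) ∧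
    (∀ z, Y.r.map (c.hom.app z) ≫ t.β z = s.β z)

lemma Rel.refl (s : SpanTriple X Y) : Rel s s :=
  ⟨Iso.refl _, by simp, by simp⟩

lemma Rel.symm {s t : SpanTriple X Y} : Rel s t → Rel t s := by
  rintro ⟨c, h₁, h₂⟩
  refine ⟨c.symm, fun z => ?_, fun z => ?_⟩
  · simp [← h₁, ← Functor.map_comp]
  · simp [← h₂, ← Functor.map_comp_assoc]

lemma Rel.trans {s t w : SpanTriple X Y} : Rel s t → Rel t w → Rel s w := by
  rintro ⟨c, h₁, h₂⟩ ⟨d, h₃, h₄⟩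
  refine ⟨c ≪≫ d, fun z => ?_, fun z => ?_⟩
  · simp [← h₃, ← h₁]
  · simp [← h₂, ← h₄]

instance setoid (X Y : RfSpan H G) : Setoid (SpanTriple X Y) where
  r := Rel
  iseqv := ⟨Rel.refl, Rel.symm, Rel.trans⟩

/-- Since the right leg of `Y` is faithful, naturality of a comparison of triples is automatic. -/
lemma sound {s t : SpanTriple X Y} (c : ∀ z, s.p.obj z ⟶ t.p.obj z)
    (h₁ : ∀ z, s.α z ≫ Y.l.map (c z) = t.α z)
    (h₂ : ∀ z, Y.r.map (c z) ≫ t.β z = s.β z) :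
    (Quotient.mk (setoid X Y) s) = Quotient.mk (setoid X Y) t := by
  apply Quotient.sound
  have nat : ∀ {z w} (f : z ⟶ w), s.p.map f ≫ c w = c z ≫ t.p.map f := by
    intro z w f
    have := Y.faithful
    apply Y.r.map_injective
    rw [← cancel_mono (t.β w), Functor.map_comp, Functor.map_comp, Category.assoc, Category.assoc,
      h₂, s.β_nat, t.β_nat, reassoc_of% h₂]
  exact ⟨NatIso.ofComponents (fun z => asIso (c z)) nat, h₁, h₂⟩

lemma Rel.exists_app {s t : SpanTriple X Y} (h : Rel s t) :
    ∃ c : ∀ z, s.p.obj z ⟶ t.p.obj z, (∀ z, s.α z ≫ Y.l.map (c z) = t.α z) ∧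
      (∀ z, Y.r.map (c z) ≫ t.β z = s.β z) := by
  obtain ⟨c, h₁, h₂⟩ := h
  exact ⟨fun z => c.hom.app z, h₁, h₂⟩

/-- The identity triple. -/
@[reducible]
def id (X : RfSpan H G) : SpanTriple X X where
  p := { obj := fun z => z, map := fun f => f, map_id := fun _ => rfl, map_comp := fun _ _ => rfl }
  α := fun z => 𝟙 (X.l.obj z)
  α_nat := by simp
  β := fun z => 𝟙 (X.r.obj z)
  β_nat := by simp

/-- Vertical composition of triples. -/
@[reducible]
def comp (s : SpanTriple X Y) (t : SpanTriple Y Z) : SpanTriple X Z where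
  p :=
    { obj := fun z => t.p.obj (s.p.obj z)
      map := fun f => t.p.map (s.p.map f)
      map_id := by simp
      map_comp := by simp }
  α := fun z => s.α z ≫ t.α (s.p.obj z)
  α_nat := fun f => by rw [← Category.assoc, s.α_nat, Category.assoc, t.α_nat, Category.assoc]
  β := fun z => t.β (s.p.obj z) ≫ s.β z
  β_nat := fun f => by rw [← Category.assoc, t.β_nat, Category.assoc, s.β_nat, Category.assoc]

lemma comp_rel {s s' : SpanTriple X Y} {t t' : SpanTriple Y Z} (hs : Rel s s') (ht : Rel t t') :
    Quotient.mk (setoid X Z) (s.comp t) = Quotient.mk (setoid X Z) (s'.comp t') := by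
  obtain ⟨c, h₁, h₂⟩ := hs.exists_app
  obtain ⟨d, h₃, h₄⟩ := ht.exists_app
  refine sound (fun z => d _ ≫ t'.p.map (c z)) (fun z => ?_) (fun z => ?_)
  · rw [Functor.map_comp, Category.assoc, reassoc_of% h₃, ← t'.α_nat, reassoc_of% h₁]
  · rw [Functor.map_comp, Category.assoc, reassoc_of% t'.β_nat, h₂, reassoc_of% h₄]

end SpanTriple

/-- The category of right-faithful spans from `H` to `G`; its morphisms are the isomorphism classes
`[p, α, β]` of triples. -/
instance RfSpan.category (H G : FinGpd.{u}) : Category.{u} (RfSpan H G) where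
  Hom X Y := Quotient (SpanTriple.setoid X Y)
  id X := Quotient.mk _ (SpanTriple.id X)
  comp {X Y Z} := Quotient.lift₂ (fun s t => Quotient.mk _ (s.comp t))
    (fun _ _ _ _ hs ht => SpanTriple.comp_rel hs ht)
  id_comp := by
    rintro X Y ⟨s⟩
    exact SpanTriple.sound (fun z => 𝟙 (s.p.obj z)) (fun z => by simp) (fun z => by simp)
  comp_id := by
    rintro X Y ⟨s⟩
    exact SpanTriple.sound (fun z => 𝟙 (s.p.obj z)) (fun z => by simp) (fun z => by simp)
  assoc := by
    rintro W X Y Z ⟨s⟩ ⟨t⟩ ⟨w⟩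
    exact SpanTriple.sound (fun z => 𝟙 (w.p.obj (t.p.obj (s.p.obj z))))
      (fun z => by simp) (fun z => by simp)

namespace RfSpan

variable {K H G F : FinGpd.{u}}

/-- The comma category of a cospan of groupoids is a groupoid; it is the iso-comma groupoid of the
cospan, as all its structure morphisms are invertible. -/
@[reducible]
def commaGroupoid {A B T : FinGpd.{u}} (L : A ⥤ T) (R : B ⥤ T) :
    Groupoid.{u} (Comma L R) where
  inv f :=
    { left := Groupoid.inv f.left
      right := Groupoid.inv f.right
      w := by
        have h := f.w
        simp only [Groupoid.inv_eq_inv, Functor.map_inv]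
        rw [IsIso.inv_comp_eq, ← Category.assoc, h, Category.assoc, IsIso.hom_inv_id,
          Category.comp_id] }
  inv_comp f := by ext <;> simp
  comp_inv f := by ext <;> simp

/-- The iso-comma groupoid (Mackey square) of a cospan of finite groupoids: its objects are triples
`(a, b, θ : L a ≅ R b)`, its morphisms the pairs of morphisms compatible with the `θ`. -/
@[reducible]
def isoComma {A B T : FinGpd.{u}} (L : A ⥤ T) (R : B ⥤ T) : FinGpd.{u} where
  carrier := Comma L R
  grpd := commaGroupoid L R
  finiteObj := Finite.of_injective
    (fun x : Comma L R => (⟨x.left, x.right, x.hom⟩ : Σ a b, L.obj a ⟶ R.obj b)) (by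
      rintro ⟨a, b, f⟩ ⟨a', b', f'⟩ h
      simp only [Sigma.mk.injEq] at h
      obtain ⟨rfl, h⟩ := h
      simp only [heq_eq_eq, Sigma.mk.injEq] at h
      obtain ⟨rfl, h⟩ := h
      simp only [heq_eq_eq] at h
      rw [h])
  finiteHom x y := Finite.of_injective
    (fun f : x ⟶ y => ((f.left, f.right) : (x.left ⟶ y.left) × (x.right ⟶ y.right))) (by
      intro f g h
      simp only [Prod.mk.injEq] at h
      exact CommaMorphism.ext h.1 h.2)

/-- The identity span, both of whose legs are the identity functor. -/
@[reducible]
def id (G : FinGpd.{u}) : RfSpan G G where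
  apex := G
  l := { obj := fun x => x, map := fun f => f, map_id := fun _ => rfl, map_comp := fun _ _ => rfl }
  r := { obj := fun x => x, map := fun f => f, map_id := fun _ => rfl, map_comp := fun _ _ => rfl }
  faithful := { map_injective := fun h => h }

/-- Horizontal composition of spans `K ← P → H` and `H ← Q → G`, through the iso-comma groupoid
of `P → H ← Q` and its projections to `P` and `Q`. -/
@[reducible]
def comp (X : RfSpan K H) (Y : RfSpan H G) : RfSpan K G where
  apex := isoComma X.r Y.l
  l :=
    { obj := fun z => X.l.obj z.left
      map := fun f => X.l.map f.left
      map_id := by simp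
      map_comp := by simp }
  r :=
    { obj := fun z => Y.r.obj z.right
      map := fun f => Y.r.map f.right
      map_id := by simp
      map_comp := by simp }
  faithful :=
    { map_injective := fun {x y} f g h => by
        have := X.faithful
        have := Y.faithful
        have h₁ : f.right = g.right := Y.r.map_injective h
        refine CommaMorphism.ext (X.r.map_injective ?_) h₁
        have e := f.w
        rw [h₁, ← g.w] at e
        exact (cancel_mono y.hom).1 e }

end RfSpan

namespace SpanTriple

variable {K H G F : FinGpd.{u}}

/-- Left whiskering of a triple by a span. -/
@[reducible]
def whiskerLeft (X : RfSpan K H) {Y Y' : RfSpan H G} (t : SpanTriple Y Y') :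
    SpanTriple (X.comp Y) (X.comp Y') where
  p :=
    { obj := fun z => { left := z.left, right := t.p.obj z.right, hom := z.hom ≫ t.α z.right }
      map := fun f =>
        { left := f.left
          right := t.p.map f.right
          w := by rw [← Category.assoc, f.w, Category.assoc, t.α_nat, Category.assoc] }
      map_id := fun z => by ext <;> simp
      map_comp := fun f g => by ext <;> simp }
  α := fun z => 𝟙 (X.l.obj z.left)
  α_nat := by simp
  β := fun z => t.β z.right
  β_nat := fun f => t.β_nat f.right

/-- Right whiskering of a triple by a span. -/
@[reducible]
def whiskerRight {X X' : RfSpan K H} (t : SpanTriple X X') (Y : RfSpan H G) :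
    SpanTriple (X.comp Y) (X'.comp Y) where
  p :=
    { obj := fun z => { left := t.p.obj z.left, right := z.right, hom := t.β z.left ≫ z.hom }
      map := fun f =>
        { left := t.p.map f.left
          right := f.right
          w := by rw [← Category.assoc, t.β_nat, Category.assoc, f.w, Category.assoc] }
      map_id := fun z => by ext <;> simp
      map_comp := fun f g => by ext <;> simp }
  α := fun z => t.α z.left
  α_nat := fun f => t.α_nat f.left
  β := fun z => 𝟙 (Y.r.obj z.right)
  β_nat := by simp

/-- The associativity comparison of spans. -/
@[reducible]
def assocHom (X : RfSpan K H) (Y : RfSpan H G) (Z : RfSpan G F) :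
    SpanTriple ((X.comp Y).comp Z) (X.comp (Y.comp Z)) where
  p :=
    { obj := fun z =>
        { left := z.left.left
          right := { left := z.left.right, right := z.right, hom := z.hom }
          hom := z.left.hom }
      map := fun f =>
        { left := f.left.left
          right := { left := f.left.right, right := f.right, w := f.w }
          w := f.left.w }
      map_id := fun z => rfl
      map_comp := fun f g => rfl }
  α := fun z => 𝟙 (X.l.obj z.left.left)
  α_nat := by simp
  β := fun z => 𝟙 (Z.r.obj z.right)
  β_nat := by simp

/-- The inverse of the associativity comparison of spans. -/
@[reducible]
def assocInv (X : RfSpan K H) (Y : RfSpan H G) (Z : RfSpan G F) :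
    SpanTriple (X.comp (Y.comp Z)) ((X.comp Y).comp Z) where
  p :=
    { obj := fun z =>
        { left := { left := z.left, right := z.right.left, hom := z.hom }
          right := z.right.right
          hom := z.right.hom }
      map := fun f =>
        { left := { left := f.left, right := f.right.left, w := f.w }
          right := f.right.right
          w := f.right.w }
      map_id := fun z => rfl
      map_comp := fun f g => rfl }
  α := fun z => 𝟙 (X.l.obj z.left)
  α_nat := by simp
  β := fun z => 𝟙 (Z.r.obj z.right.right)
  β_nat := by simp

/-- The left unit comparison of spans. -/
@[reducible]
def leftUnitHom (X : RfSpan H G) : SpanTriple ((RfSpan.id H).comp X) X where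
  p :=
    { obj := fun z => z.right
      map := fun f => f.right
      map_id := fun _ => rfl
      map_comp := fun _ _ => rfl }
  α := fun z => z.hom
  α_nat := fun f => f.w
  β := fun z => 𝟙 (X.r.obj z.right)
  β_nat := by simp

/-- The inverse of the left unit comparison of spans. -/
@[reducible]
def leftUnitInv (X : RfSpan H G) : SpanTriple X ((RfSpan.id H).comp X) where
  p :=
    { obj := fun z => { left := X.l.obj z, right := z, hom := 𝟙 (X.l.obj z) }
      map := fun f => { left := X.l.map f, right := f }
      map_id := fun z => by ext <;> simp
      map_comp := fun f g => by ext <;> simp }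
  α := fun z => 𝟙 (X.l.obj z)
  α_nat := by simp
  β := fun z => 𝟙 (X.r.obj z)
  β_nat := by simp

/-- The right unit comparison of spans. -/
@[reducible]
def rightUnitHom (X : RfSpan H G) : SpanTriple (X.comp (RfSpan.id G)) X where
  p :=
    { obj := fun z => z.left
      map := fun f => f.left
      map_id := fun _ => rfl
      map_comp := fun _ _ => rfl }
  α := fun z => 𝟙 (X.l.obj z.left)
  α_nat := by simp
  β := fun z => z.hom
  β_nat := fun f => f.w

/-- The inverse of the right unit comparison of spans. -/
@[reducible]
def rightUnitInv (X : RfSpan H G) : SpanTriple X (X.comp (RfSpan.id G)) where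
  p :=
    { obj := fun z => { left := z, right := X.r.obj z, hom := 𝟙 (X.r.obj z) }
      map := fun f => { left := f, right := X.r.map f }
      map_id := fun z => by ext <;> simp
      map_comp := fun f g => by ext <;> simp }
  α := fun z => 𝟙 (X.l.obj z)
  α_nat := by simp
  β := fun z => 𝟙 (X.r.obj z)
  β_nat := by simp

/-- The class `[p, α, β]` of a triple, as a morphism of spans. -/
def toHom {H G : FinGpd.{u}} {X Y : RfSpan H G} (t : SpanTriple X Y) : X ⟶ Y :=
  Quotient.mk _ t

lemma whiskerLeft_rel (X : RfSpan K H) {Y Y' : RfSpan H G} {s t : SpanTriple Y Y'}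
    (h : Rel s t) : (s.whiskerLeft X).toHom = (t.whiskerLeft X).toHom := by
  obtain ⟨c, h₁, h₂⟩ := h.exists_app
  exact sound (fun z => { left := 𝟙 z.left, right := c z.right, w := by simp [h₁] })
    (fun z => by simp) (fun z => h₂ z.right)

lemma whiskerRight_rel {X X' : RfSpan K H} {s t : SpanTriple X X'} (h : Rel s t)
    (Y : RfSpan H G) : (s.whiskerRight Y).toHom = (t.whiskerRight Y).toHom := by
  obtain ⟨c, h₁, h₂⟩ := h.exists_app
  exact sound
    (fun z => { left := c z.left, right := 𝟙 z.right, w := by simp [reassoc_of% h₂] })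
    (fun z => h₁ z.left) (fun z => by simp)

end SpanTriple

/-- The objects of the bicategory of right-faithful spans are the finite groupoids. -/
@[ext]
structure SpanRf : Type (u + 1) where
  gpd : FinGpd.{u}

namespace SpanRf

open SpanTriple

instance : CategoryStruct.{u + 1} SpanRf.{u} where
  Hom H G := RfSpan H.gpd G.gpd
  id G := RfSpan.id G.gpd
  comp X Y := RfSpan.comp X Y

/-- The category structure on the spans between two finite groupoids. -/
instance (H G : SpanRf.{u}) : Category.{u} (H ⟶ G) :=
  RfSpan.category H.gpd G.gpd

variable {L K H G F : FinGpd.{u}}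

/-- Left whiskering of a 2-cell of spans. -/
def whiskerL (X : RfSpan K H) {Y Y' : RfSpan H G} (t : Y ⟶ Y') : X.comp Y ⟶ X.comp Y' :=
  Quotient.lift (fun t => (SpanTriple.whiskerLeft X t).toHom) (fun _ _ h => whiskerLeft_rel X h) t

/-- Right whiskering of a 2-cell of spans. -/
def whiskerR {X X' : RfSpan K H} (t : X ⟶ X') (Y : RfSpan H G) : X.comp Y ⟶ X'.comp Y :=
  Quotient.lift (fun t => (SpanTriple.whiskerRight t Y).toHom) (fun _ _ h => whiskerRight_rel h Y) t

/-- The associator of the bicategory of spans. -/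
def assoc (X : RfSpan K H) (Y : RfSpan H G) (Z : RfSpan G F) :
    (X.comp Y).comp Z ≅ X.comp (Y.comp Z) where
  hom := (assocHom X Y Z).toHom
  inv := (assocInv X Y Z).toHom
  hom_inv_id := sound (fun z => 𝟙 z)
    (fun z => by simp) (fun z => by simp)
  inv_hom_id := sound (fun z => 𝟙 z)
    (fun z => by simp) (fun z => by simp)

/-- The left unitor of the bicategory of spans. -/
def leftUnit (X : RfSpan H G) : (RfSpan.id H).comp X ≅ X where
  hom := (leftUnitHom X).toHom
  inv := (leftUnitInv X).toHom
  hom_inv_id := sound (fun z => { left := inv z.hom, right := 𝟙 z.right })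
    (fun z => by simp) (fun z => by simp)
  inv_hom_id := sound (fun z => 𝟙 z)
    (fun z => by simp) (fun z => by simp)

/-- The right unitor of the bicategory of spans. -/
def rightUnit (X : RfSpan H G) : X.comp (RfSpan.id G) ≅ X where
  hom := (rightUnitHom X).toHom
  inv := (rightUnitInv X).toHom
  hom_inv_id := sound (fun z => { left := 𝟙 z.left, right := z.hom })
    (fun z => by simp) (fun z => by simp)
  inv_hom_id := sound (fun z => 𝟙 z)
    (fun z => by simp) (fun z => by simp)

lemma whiskerL_id (X : RfSpan K H) (Y : RfSpan H G) : whiskerL X (𝟙 Y) = 𝟙 (X.comp Y) :=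
  sound (fun z => { left := 𝟙 z.left, right := 𝟙 z.right })
    (fun z => by simp) (fun z => by simp)

lemma whiskerL_comp (X : RfSpan K H) {Y Y' Y'' : RfSpan H G} (s : Y ⟶ Y') (t : Y' ⟶ Y'') :
    whiskerL X (s ≫ t) = whiskerL X s ≫ whiskerL X t := by
  obtain ⟨s⟩ := s
  obtain ⟨t⟩ := t
  exact sound (fun z => { left := 𝟙 z.left, right := 𝟙 (t.p.obj (s.p.obj z.right)) })
    (fun z => by simp) (fun z => by simp)

lemma id_whiskerL {Y Y' : RfSpan H G} (t : Y ⟶ Y') :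
    whiskerL (RfSpan.id H) t = (leftUnit Y).hom ≫ t ≫ (leftUnit Y').inv := by
  obtain ⟨t⟩ := t
  exact sound (fun z => { left := z.hom ≫ t.α z.right, right := 𝟙 (t.p.obj z.right) })
    (fun z => by simp) (fun z => by simp)

lemma comp_whiskerL (W : RfSpan L K) (X : RfSpan K H) {Y Y' : RfSpan H G} (t : Y ⟶ Y') :
    whiskerL (W.comp X) t = (assoc W X Y).hom ≫ whiskerL W (whiskerL X t) ≫ (assoc W X Y').inv := by
  obtain ⟨t⟩ := t
  exact sound (fun z => {
      left := { left := 𝟙 z.left.left, right := 𝟙 z.left.right },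
      right := 𝟙 (t.p.obj z.right) })
    (fun z => by simp) (fun z => by simp)

lemma id_whiskerR (X : RfSpan K H) (Y : RfSpan H G) : whiskerR (𝟙 X) Y = 𝟙 (X.comp Y) :=
  sound (fun z => { left := 𝟙 z.left, right := 𝟙 z.right })
    (fun z => by simp) (fun z => by simp)

lemma comp_whiskerR {X X' X'' : RfSpan K H} (s : X ⟶ X') (t : X' ⟶ X'') (Y : RfSpan H G) :
    whiskerR (s ≫ t) Y = whiskerR s Y ≫ whiskerR t Y := by
  obtain ⟨s⟩ := s
  obtain ⟨t⟩ := t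
  exact sound (fun z => { left := 𝟙 (t.p.obj (s.p.obj z.left)), right := 𝟙 z.right })
    (fun z => by simp) (fun z => by simp)

lemma whiskerR_id {X X' : RfSpan H G} (t : X ⟶ X') :
    whiskerR t (RfSpan.id G) = (rightUnit X).hom ≫ t ≫ (rightUnit X').inv := by
  obtain ⟨t⟩ := t
  exact sound (fun z => { left := 𝟙 (t.p.obj z.left), right := inv (t.β z.left ≫ z.hom) })
    (fun z => by simp) (fun z => by simp)

lemma whiskerR_comp {X X' : RfSpan L K} (t : X ⟶ X') (Y : RfSpan K H) (Z : RfSpan H G) :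
    whiskerR t (Y.comp Z) = (assoc X Y Z).inv ≫ whiskerR (whiskerR t Y) Z ≫ (assoc X' Y Z).hom := by
  obtain ⟨t⟩ := t
  exact sound (fun z => {
      left := 𝟙 (t.p.obj z.left),
      right := { left := 𝟙 z.right.left, right := 𝟙 z.right.right } })
    (fun z => by simp) (fun z => by simp)

lemma whisker_assoc (W : RfSpan L K) {X X' : RfSpan K H} (t : X ⟶ X') (Y : RfSpan H G) :
    whiskerR (whiskerL W t) Y =
      (assoc W X Y).hom ≫ whiskerL W (whiskerR t Y) ≫ (assoc W X' Y).inv := by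
  obtain ⟨t⟩ := t
  exact sound
    (fun z => {
      left := { left := 𝟙 z.left.left, right := 𝟙 (t.p.obj z.left.right) }
      right := 𝟙 z.right })
    (fun z => by simp) (fun z => by simp)

lemma whisker_exchange {X X' : RfSpan K H} {Y Y' : RfSpan H G} (s : X ⟶ X') (t : Y ⟶ Y') :
    whiskerL X t ≫ whiskerR s Y' = whiskerR s Y ≫ whiskerL X' t := by
  obtain ⟨s⟩ := s
  obtain ⟨t⟩ := t
  exact sound (fun z => { left := 𝟙 (s.p.obj z.left), right := 𝟙 (t.p.obj z.right) })
    (fun z => by simp) (fun z => by simp)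

lemma pentagon (W : RfSpan L K) (X : RfSpan K H) (Y : RfSpan H G) (Z : RfSpan G F) :
    whiskerR (assoc W X Y).hom Z ≫ (assoc W (X.comp Y) Z).hom ≫ whiskerL W (assoc X Y Z).hom =
      (assoc (W.comp X) Y Z).hom ≫ (assoc W X (Y.comp Z)).hom :=
  sound
    (fun z => {
      left := 𝟙 z.left.left.left
      right := {
        left := 𝟙 z.left.left.right
        right := { left := 𝟙 z.left.right, right := 𝟙 z.right } } })
    (fun z => by simp) (fun z => by simp)

lemma triangle (X : RfSpan K H) (Y : RfSpan H G) :
    (assoc X (RfSpan.id H) Y).hom ≫ whiskerL X (leftUnit Y).hom = whiskerR (rightUnit X).hom Y :=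
  sound (fun z => { left := 𝟙 z.left.left, right := 𝟙 z.right })
    (fun z => by simp) (fun z => by simp)

/-- The bicategory of finite groupoids, right-faithful spans, and isomorphism classes of
morphisms of spans. -/
instance bicategory : Bicategory.{u, u + 1} SpanRf.{u} where
  homCategory H G := RfSpan.category H.gpd G.gpd
  whiskerLeft X _ _ t := whiskerL X t
  whiskerRight t Y := whiskerR t Y
  associator X Y Z := assoc X Y Z
  leftUnitor X := leftUnit X
  rightUnitor X := rightUnit X
  whiskerLeft_id X Y := whiskerL_id X Y
  whiskerLeft_comp X _ _ _ s t := whiskerL_comp X s t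
  id_whiskerLeft t := id_whiskerL t
  comp_whiskerLeft W X _ _ t := comp_whiskerL W X t
  id_whiskerRight X Y := id_whiskerR X Y
  comp_whiskerRight s t Y := comp_whiskerR s t Y
  whiskerRight_id t := whiskerR_id t
  whiskerRight_comp t Y Z := whiskerR_comp t Y Z
  whisker_assoc W _ _ t Y := whisker_assoc W t Y
  whisker_exchange s t := whisker_exchange s t
  pentagon W X Y Z := pentagon W X Y Z
  triangle X Y := triangle X Y

end SpanRf

/-- A right-free finite `G,H`-biset: a functor `Hᵒᵖ × G ⥤ Type` with finite values, on which the
right action of `H` is free. It is a 1-cell from `H` to `G`. -/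
structure RfBiset (H G : FinGpd.{u}) : Type (u + 1) where
  functor : Hᵒᵖ × G ⥤ Type u
  finite : ∀ z, Finite (functor.obj z)
  rightFree : ∀ (y : H) (x : G) (s : functor.obj (Opposite.op y, x)) (h : y ⟶ y),
    functor.map (X := (Opposite.op y, x)) (Y := (Opposite.op y, x)) (h.op, 𝟙 x) s = s → h = 𝟙 y

/-- The category of right-free `G,H`-bisets; its morphisms are the equivariant maps, that is the
natural transformations. -/
instance RfBiset.category (H G : FinGpd.{u}) : Category.{u} (RfBiset H G) where
  Hom S T := S.functor ⟶ T.functor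
  id S := 𝟙 S.functor
  comp φ ψ := NatTrans.vcomp φ ψ

namespace RfBiset

variable {L K H G F : FinGpd.{u}}

/-- The set of elements of a biset at a pair of objects. -/
abbrev El (S : RfBiset H G) (y : H) (x : G) : Type u := S.functor.obj (Opposite.op y, x)

instance (S : RfBiset H G) (y : H) (x : G) : Finite (S.El y x) := S.finite _

/-- The two-sided action `g · s · h`. -/
def act (S : RfBiset H G) {y y' : H} {x x' : G} (h : y' ⟶ y) (g : x ⟶ x') (s : S.El y x) :
    S.El y' x' :=
  S.functor.map (X := (Opposite.op y, x)) (Y := (Opposite.op y', x')) (h.op, g) s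

@[simp]
lemma act_id (S : RfBiset H G) {y : H} {x : G} (s : S.El y x) : S.act (𝟙 y) (𝟙 x) s = s :=
  Functor.map_id_apply S.functor (Opposite.op y, x) s

@[simp]
lemma act_act (S : RfBiset H G) {y y' y'' : H} {x x' x'' : G} (h : y' ⟶ y) (g : x ⟶ x')
    (h' : y'' ⟶ y') (g' : x' ⟶ x'') (s : S.El y x) :
    S.act h' g' (S.act h g s) = S.act (h' ≫ h) (g ≫ g') s :=
  (S.functor.map_comp_apply (X := (Opposite.op y, x)) (Y := (Opposite.op y', x'))
    (Z := (Opposite.op y'', x'')) (h.op, g) (h'.op, g') s).symm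

lemma free (S : RfBiset H G) {y : H} {x : G} (s : S.El y x) (h : y ⟶ y)
    (e : S.act h (𝟙 x) s = s) : h = 𝟙 y :=
  S.rightFree y x s h e

/-- Build a functor `Hᵒᵖ × G ⥤ Type` from its elements and its two-sided action. -/
@[reducible]
def mkFunctor (E : H → G → Type u)
    (a : ∀ {y y' : H} {x x' : G}, (y' ⟶ y) → (x ⟶ x') → E y x → E y' x')
    (a_id : ∀ {y : H} {x : G} (s : E y x), a (𝟙 y) (𝟙 x) s = s)
    (a_a : ∀ {y y' y'' : H} {x x' x'' : G} (h : y' ⟶ y) (g : x ⟶ x') (h' : y'' ⟶ y')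
      (g' : x' ⟶ x'') (s : E y x), a h' g' (a h g s) = a (h' ≫ h) (g ≫ g') s) :
    Hᵒᵖ × G ⥤ Type u where
  obj z := E z.1.unop z.2
  map f := ↾(fun s => a f.1.unop f.2 s)
  map_id z := by ext s; exact a_id s
  map_comp f g := by ext s; exact (a_a _ _ _ _ s).symm

/-- The component of an equivariant map. -/
def app {S T : RfBiset H G} (φ : S ⟶ T) {y : H} {x : G} (s : S.El y x) : T.El y x :=
  NatTrans.app φ (Opposite.op y, x) s

lemma app_act {S T : RfBiset H G} (φ : S ⟶ T) {y y' : H} {x x' : G} (h : y' ⟶ y) (g : x ⟶ x')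
    (s : S.El y x) : app φ (S.act h g s) = T.act h g (app φ s) :=
  NatTrans.naturality_apply φ (X := (Opposite.op y, x)) (Y := (Opposite.op y', x')) (h.op, g) s

@[simp]
lemma app_id (S : RfBiset H G) {y : H} {x : G} (s : S.El y x) : app (𝟙 S) s = s := rfl

@[simp]
lemma app_comp {S T U : RfBiset H G} (φ : S ⟶ T) (ψ : T ⟶ U) {y : H} {x : G} (s : S.El y x) :
    app (φ ≫ ψ) s = app ψ (app φ s) := rfl

lemma hom_ext {S T : RfBiset H G} {φ ψ : S ⟶ T}
    (h : ∀ (y : H) (x : G) (s : S.El y x), app φ s = app ψ s) : φ = ψ := by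
  apply NatTrans.ext
  funext z
  ext s
  exact h _ _ s

/-- Build an equivariant map from its components. -/
def mkHom {S T : RfBiset H G} (f : ∀ {y : H} {x : G}, S.El y x → T.El y x)
    (hf : ∀ {y y' : H} {x x' : G} (h : y' ⟶ y) (g : x ⟶ x') (s : S.El y x),
      f (S.act h g s) = T.act h g (f s)) : S ⟶ T :=
  NatTrans.mk (F := S.functor) (G := T.functor) (fun z => ↾(fun s => f (y := z.1.unop) (x := z.2) s))
    (by
      intro z w k
      ext s
      exact hf k.1.unop k.2 s)

@[simp]
lemma app_mkHom {S T : RfBiset H G} (f : ∀ {y : H} {x : G}, S.El y x → T.El y x)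
    (hf : ∀ {y y' : H} {x x' : G} (h : y' ⟶ y) (g : x ⟶ x') (s : S.El y x),
      f (S.act h g s) = T.act h g (f s)) {y : H} {x : G} (s : S.El y x) :
    app (mkHom f hf) s = f s := rfl

/-- The identity biset `G(-,-)`. -/
@[reducible]
def id (G : FinGpd.{u}) : RfBiset G G where
  functor := mkFunctor (fun y x => y ⟶ x) (fun h g s => h ≫ s ≫ g) (by simp) (by simp)
  finite _ := inferInstance
  rightFree y x s h e := by
    have e : h ≫ s ≫ 𝟙 x = s := e
    rw [Category.comp_id] at e
    rw [← cancel_mono s, e, Category.id_comp]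

lemma id_act {y y' x x' : G} (h : y' ⟶ y) (g : x ⟶ x') (s : y ⟶ x) :
    (id G).act h g s = h ≫ s ≫ g := rfl

section Tensor

variable (S : RfBiset K H) (T : RfBiset H G)

/-- The pairs `(t, s)` at an object `y` of `H`, with `t ∈ T(y, x)` and `s ∈ S(z, y)`. -/
abbrev Pair (z : K) (x : G) : Type u := Σ y : H, T.El y x × S.El z y

/-- Pairs `(t, s)` and `(t', s')` are equivalent if `(t, g · s) = (t' · g, s')` for some `g`. -/
def PairRel {z : K} {x : G} (a b : Pair S T z x) : Prop :=
  ∃ g : a.1 ⟶ b.1, a.2.1 = T.act g (𝟙 x) b.2.1 ∧ S.act (𝟙 z) g a.2.2 = b.2.2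

instance pairSetoid (z : K) (x : G) : Setoid (Pair S T z x) where
  r := PairRel S T
  iseqv :=
    { refl := fun a => ⟨𝟙 _, by simp, by simp⟩
      symm := by
        rintro a b ⟨g, h₁, h₂⟩
        exact ⟨inv g, by simp [h₁], by simp [← h₂]⟩
      trans := by
        rintro a b c ⟨g, h₁, h₂⟩ ⟨g', h₃, h₄⟩
        exact ⟨g ≫ g', by simp [h₁, h₃], by simp [← h₂, ← h₄]⟩ }

/-- The set of elements of the tensor product `T ×_H S` at `(z, x)`. -/
abbrev Tensor (z : K) (x : G) : Type u := Quotient (pairSetoid S T z x)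

variable {S T}

/-- The class `[t, s]` at `y`. -/
def tmk {z : K} {x : G} {y : H} (t : T.El y x) (s : S.El z y) : Tensor S T z x :=
  Quotient.mk _ ⟨y, t, s⟩

lemma tmk_act {z : K} {x : G} {y y' : H} (g : y ⟶ y') (t : T.El y' x) (s : S.El z y) :
    (tmk (T.act g (𝟙 x) t) s : Tensor S T z x) = tmk t (S.act (𝟙 z) g s) :=
  Quotient.sound ⟨g, rfl, rfl⟩

lemma tmk_eq_iff {z : K} {x : G} {y y' : H} {t : T.El y x} {s : S.El z y} {t' : T.El y' x}
    {s' : S.El z y'} : (tmk t s : Tensor S T z x) = tmk t' s' ↔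
      ∃ g : y ⟶ y', t = T.act g (𝟙 x) t' ∧ S.act (𝟙 z) g s = s' :=
  ⟨fun h => Quotient.exact h, fun h => Quotient.sound h⟩

lemma tensor_ind {z : K} {x : G} {P : Tensor S T z x → Prop}
    (h : ∀ (y : H) (t : T.El y x) (s : S.El z y), P (tmk t s)) (a : Tensor S T z x) : P a :=
  Quotient.ind (fun ⟨y, t, s⟩ => h y t s) a

/-- Descend a balanced map to the tensor product. -/
def tlift {z : K} {x : G} {A : Type u} (f : ∀ {y : H}, T.El y x → S.El z y → A)
    (hf : ∀ {y y' : H} (g : y ⟶ y') (t : T.El y' x) (s : S.El z y),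
      f (T.act g (𝟙 x) t) s = f t (S.act (𝟙 z) g s)) (a : Tensor S T z x) : A :=
  Quotient.lift (fun b : Pair S T z x => f b.2.1 b.2.2) (by
    rintro ⟨y, t, s⟩ ⟨y', t', s'⟩ ⟨g, h₁, h₂⟩
    dsimp only at h₁ h₂ ⊢
    rw [h₁, hf, h₂]) a

variable (S T)

/-- The actions `g · [t, s] = [g · t, s]` and `[t, s] · k = [t, s · k]`, taken together. -/
def tact {z z' : K} {x x' : G} (k : z' ⟶ z) (g : x ⟶ x') : Tensor S T z x → Tensor S T z' x' :=
  tlift (fun {y} t s => tmk (T.act (𝟙 y) g t) (S.act k (𝟙 y) s)) (by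
    intro y y' h t s
    simpa using tmk_act h (T.act (𝟙 y') g t) (S.act k (𝟙 y) s))

@[simp]
lemma tact_tmk {z z' : K} {x x' : G} {y : H} (k : z' ⟶ z) (g : x ⟶ x') (t : T.El y x)
    (s : S.El z y) :
    tact S T k g (tmk t s) = tmk (T.act (𝟙 y) g t) (S.act k (𝟙 y) s) := rfl

/-- The composite biset, which is the tensor product `T ×_H S`. -/
@[reducible]
def comp : RfBiset K G where
  functor := mkFunctor (fun z x => Tensor S T z x) (fun k g a => tact S T k g a)
    (fun a => by
      induction a using tensor_ind
      simp)
    (fun h g h' g' a => by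
      induction a using tensor_ind
      simp)
  finite z := Quotient.finite (pairSetoid S T z.1.unop z.2)
  rightFree z x a k e := by
    induction a using tensor_ind with
    | h y t s =>
      obtain ⟨g, h₁, h₂⟩ := tmk_eq_iff.1 e
      have hg : g = 𝟙 y := T.free t g (by simpa using h₁.symm)
      subst hg
      exact S.free s k (by simpa using h₂)

variable {S T}

lemma comp_act {z z' : K} {x x' : G} {y : H} (k : z' ⟶ z) (g : x ⟶ x') (t : T.El y x)
    (s : S.El z y) :
    (comp S T).act k g (tmk t s) = tmk (T.act (𝟙 y) g t) (S.act k (𝟙 y) s) := rfl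

lemma comp_ext {U : RfBiset K G} {φ ψ : comp S T ⟶ U}
    (h : ∀ (z : K) (x : G) (y : H) (t : T.El y x) (s : S.El z y),
      app (y := z) (x := x) φ (tmk t s) = app (y := z) (x := x) ψ (tmk t s)) : φ = ψ :=
  hom_ext (fun z x => tensor_ind (S := S) (T := T) (P := fun a => app φ a = app ψ a)
    (fun y t s => h z x y t s))

/-- Build an equivariant map out of a composite biset. -/
def compDesc {U : RfBiset K G} (f : ∀ {z : K} {x : G} {y : H}, T.El y x → S.El z y → U.El z x)
    (hf : ∀ {z : K} {x : G} {y y' : H} (g : y ⟶ y') (t : T.El y' x) (s : S.El z y),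
      f (T.act g (𝟙 x) t) s = f t (S.act (𝟙 z) g s))
    (hf' : ∀ {z z' : K} {x x' : G} {y : H} (k : z' ⟶ z) (g : x ⟶ x') (t : T.El y x) (s : S.El z y),
      f (T.act (𝟙 y) g t) (S.act k (𝟙 y) s) = U.act k g (f t s)) : comp S T ⟶ U :=
  mkHom (fun a => tlift (fun t s => f t s) (fun g t s => hf g t s) a)
    (fun k g a => by
      revert a
      refine tensor_ind (S := S) (T := T) (fun y t s => ?_)
      exact hf' k g t s)

@[simp]
lemma app_compDesc {U : RfBiset K G}
    (f : ∀ {z : K} {x : G} {y : H}, T.El y x → S.El z y → U.El z x)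
    (hf : ∀ {z : K} {x : G} {y y' : H} (g : y ⟶ y') (t : T.El y' x) (s : S.El z y),
      f (T.act g (𝟙 x) t) s = f t (S.act (𝟙 z) g s))
    (hf' : ∀ {z z' : K} {x x' : G} {y : H} (k : z' ⟶ z) (g : x ⟶ x') (t : T.El y x) (s : S.El z y),
      f (T.act (𝟙 y) g t) (S.act k (𝟙 y) s) = U.act k g (f t s))
    {z : K} {x : G} {y : H} (t : T.El y x) (s : S.El z y) :
    app (y := z) (x := x) (compDesc f hf hf') (tmk t s) = f t s := rfl

end Tensor

end RfBiset

/-- The objects of the bicategory of right-free bisets are the finite groupoids. -/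
@[ext]
structure BisetRf : Type (u + 1) where
  gpd : FinGpd.{u}

namespace BisetRf

open RfBiset

instance : CategoryStruct.{u + 1} BisetRf.{u} where
  Hom H G := RfBiset H.gpd G.gpd
  id G := RfBiset.id G.gpd
  comp S T := RfBiset.comp S T

/-- The category structure on the bisets between two finite groupoids. -/
instance (H G : BisetRf.{u}) : Category.{u} (H ⟶ G) :=
  RfBiset.category H.gpd G.gpd

variable {L K H G F : FinGpd.{u}}

/-- Left whiskering: `[t, s] ↦ [φ t, s]`. -/
def whiskerL (S : RfBiset K H) {T T' : RfBiset H G} (φ : T ⟶ T') : comp S T ⟶ comp S T' :=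
  compDesc (fun t s => (tmk (app φ t) s : Tensor S T' _ _))
    (fun g t s => by rw [app_act, tmk_act])
    (fun k g t s => by rw [app_act, comp_act])

@[simp]
lemma app_whiskerL (S : RfBiset K H) {T T' : RfBiset H G} (φ : T ⟶ T') {z : K} {x : G} {y : H}
    (t : T.El y x) (s : S.El z y) :
    app (y := z) (x := x) (whiskerL S φ) (tmk t s) = (tmk (app φ t) s : Tensor S T' z x) := rfl

/-- Right whiskering: `[t, s] ↦ [t, φ s]`. -/
def whiskerR {S S' : RfBiset K H} (φ : S ⟶ S') (T : RfBiset H G) : comp S T ⟶ comp S' T :=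
  compDesc (fun t s => (tmk t (app φ s) : Tensor S' T _ _))
    (fun g t s => by rw [app_act, tmk_act])
    (fun k g t s => by rw [app_act, comp_act])

@[simp]
lemma app_whiskerR {S S' : RfBiset K H} (φ : S ⟶ S') (T : RfBiset H G) {z : K} {x : G} {y : H}
    (t : T.El y x) (s : S.El z y) :
    app (y := z) (x := x) (whiskerR φ T) (tmk t s) = (tmk t (app φ s) : Tensor S' T z x) := rfl

/-- The associativity comparison `[u, [t, s]] ↦ [[u, t], s]`. -/
def assocHom (S : RfBiset L K) (T : RfBiset K H) (U : RfBiset H G) :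
    comp (comp S T) U ⟶ comp S (comp T U) :=
  compDesc (fun {z x y} v a =>
      tlift (S := S) (T := T) (A := Tensor S (comp T U) z x)
        (fun t s => tmk (T := comp T U) (tmk v t : Tensor T U _ x) s)
        (fun g t s => by rw [← tmk_act, comp_act]; simp) a)
    (fun {z x y y'} g v a => by
      induction (a : Tensor S T z y) using tensor_ind with
      | h w t s =>
        change tmk (T := comp T U) (tmk (U.act g (𝟙 x) v) t : Tensor T U w x) s =
          tmk (T := comp T U) (tmk v (T.act (𝟙 w) g t) : Tensor T U w x) (S.act (𝟙 z) (𝟙 w) s)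
        rw [tmk_act]
        simp)
    (fun k g v a => by
      induction (a : Tensor S T _ _) using tensor_ind with
      | h w t s =>
        change tmk (T := comp T U) (tmk (U.act _ g v) (T.act (𝟙 w) _ t) : Tensor T U w _) _ =
          tmk (T := comp T U) (tmk (U.act _ g v) (T.act (𝟙 w) (𝟙 _) t) : Tensor T U w _) _
        rfl)

@[simp]
lemma app_assocHom (S : RfBiset L K) (T : RfBiset K H) (U : RfBiset H G) {w : L} {z : K} {y : H}
    {x : G} (v : U.El y x) (t : T.El z y) (s : S.El w z) :
    app (y := w) (x := x) (assocHom S T U) (tmk (S := comp S T) v (tmk t s : Tensor S T w y)) =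
      tmk (T := comp T U) (tmk v t : Tensor T U z x) s := rfl

/-- The inverse associativity comparison `[[u, t], s] ↦ [u, [t, s]]`. -/
def assocInv (S : RfBiset L K) (T : RfBiset K H) (U : RfBiset H G) :
    comp S (comp T U) ⟶ comp (comp S T) U :=
  compDesc (fun {z x y} a s =>
      tlift (S := T) (T := U) (A := Tensor (comp S T) U z x)
        (fun v t => tmk (S := comp S T) v (tmk t s : Tensor S T z _))
        (fun g v t => by rw [tmk_act, comp_act]; simp) a)
    (fun {z x y y'} g a s => by
      induction (a : Tensor T U y' x) using tensor_ind with
      | h w v t =>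
        change tmk (S := comp S T) (U.act (𝟙 w) (𝟙 x) v) (tmk (T.act g (𝟙 w) t) s : Tensor S T z w) =
          tmk (S := comp S T) v (tmk t (S.act (𝟙 z) g s) : Tensor S T z w)
        rw [act_id]
        exact congrArg (tmk (S := comp S T) v) (tmk_act g t s))
    (fun k g a s => by
      induction (a : Tensor T U _ _) using tensor_ind with
      | h w v t => rfl)

@[simp]
lemma app_assocInv (S : RfBiset L K) (T : RfBiset K H) (U : RfBiset H G) {w : L} {z : K} {y : H}
    {x : G} (v : U.El y x) (t : T.El z y) (s : S.El w z) :
    app (y := w) (x := x) (assocInv S T U) (tmk (T := comp T U) (tmk v t : Tensor T U z x) s) =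
      tmk (S := comp S T) v (tmk t s : Tensor S T w y) := rfl

lemma comp_ext₃ {S : RfBiset L K} {T : RfBiset K H} {U : RfBiset H G} {V : RfBiset L G}
    {φ ψ : comp (comp S T) U ⟶ V}
    (h : ∀ (w : L) (x : G) (y : H) (z : K) (v : U.El y x) (t : T.El z y) (s : S.El w z),
      app (y := w) (x := x) φ (tmk (S := comp S T) v (tmk t s : Tensor S T w y)) =
        app (y := w) (x := x) ψ (tmk (S := comp S T) v (tmk t s : Tensor S T w y))) : φ = ψ :=
  comp_ext (fun w x y v a => by
    induction (a : Tensor S T w y) using tensor_ind with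
    | h z t s => exact h w x y z v t s)

lemma comp_ext₃' {S : RfBiset L K} {T : RfBiset K H} {U : RfBiset H G} {V : RfBiset L G}
    {φ ψ : comp S (comp T U) ⟶ V}
    (h : ∀ (w : L) (x : G) (y : H) (z : K) (v : U.El y x) (t : T.El z y) (s : S.El w z),
      app (y := w) (x := x) φ (tmk (T := comp T U) (tmk v t : Tensor T U z x) s) =
        app (y := w) (x := x) ψ (tmk (T := comp T U) (tmk v t : Tensor T U z x) s)) : φ = ψ :=
  comp_ext (fun w x z a s => by
    induction (a : Tensor T U z x) using tensor_ind with
    | h y v t => exact h w x y z v t s)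

/-- The associator of the bicategory of bisets. -/
def assoc (S : RfBiset L K) (T : RfBiset K H) (U : RfBiset H G) :
    comp (comp S T) U ≅ comp S (comp T U) where
  hom := assocHom S T U
  inv := assocInv S T U
  hom_inv_id := comp_ext₃ (fun _ _ _ _ _ _ _ => rfl)
  inv_hom_id := comp_ext₃' (fun _ _ _ _ _ _ _ => rfl)

/-- The left unitor `[s, h] ↦ s · h` of the bicategory of bisets. -/
def leftUnit (S : RfBiset H G) : comp (RfBiset.id H) S ≅ S where
  hom := compDesc (fun {z x y} s h => S.act h (𝟙 x) s)
    (fun g s h => by simp [id_act])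
    (fun k g s h => by simp [id_act])
  inv := mkHom (fun {y x} s => tmk (S := RfBiset.id H) s (𝟙 y))
    (fun h g s => by
      rw [comp_act, id_act]
      have := tmk_act (S := RfBiset.id H) h (S.act (𝟙 _) g s) (𝟙 _)
      simpa [id_act] using this)
  hom_inv_id := comp_ext (fun z x y s h => by
    change tmk (S := RfBiset.id H) (S.act h (𝟙 x) s) (𝟙 z) = tmk (S := RfBiset.id H) s h
    rw [tmk_act, id_act]
    simp)
  inv_hom_id := hom_ext (fun y x s => S.act_id s)

/-- The right unitor `[g, s] ↦ g · s` of the bicategory of bisets. -/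
def rightUnit (S : RfBiset H G) : comp S (RfBiset.id G) ≅ S where
  hom := compDesc (fun {z x y} g s => S.act (𝟙 z) g s)
    (fun g s h => by simp [id_act])
    (fun k g s h => by simp [id_act])
  inv := mkHom (fun {y x} s => tmk (T := RfBiset.id G) (𝟙 x) s)
    (fun h g s => by
      rw [comp_act, id_act]
      have := tmk_act (T := RfBiset.id G) g (𝟙 _) (S.act h (𝟙 _) s)
      simpa [id_act] using this.symm)
  hom_inv_id := comp_ext (fun z x y g s => by
    change tmk (T := RfBiset.id G) (𝟙 x) (S.act (𝟙 z) g s) = tmk (T := RfBiset.id G) g s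
    rw [← tmk_act, id_act]
    simp)
  inv_hom_id := hom_ext (fun y x s => S.act_id s)

lemma id_whiskerL {S T : RfBiset H G} (φ : S ⟶ T) :
    whiskerL (RfBiset.id H) φ = (leftUnit S).hom ≫ φ ≫ (leftUnit T).inv :=
  comp_ext (fun z x y t h => by
    have e := tmk_act (S := RfBiset.id H) h (app φ t) (𝟙 z)
    rw [id_act] at e
    change tmk (S := RfBiset.id H) (app φ t) h =
      tmk (S := RfBiset.id H) (app φ (S.act h (𝟙 x) t)) (𝟙 z)
    rw [app_act, e]
    simp)

lemma whiskerR_id {S T : RfBiset H G} (φ : S ⟶ T) :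
    whiskerR φ (RfBiset.id G) = (rightUnit S).hom ≫ φ ≫ (rightUnit T).inv :=
  comp_ext (fun z x y g s => by
    have e := tmk_act (T := RfBiset.id G) g (𝟙 x) (app φ s)
    rw [id_act] at e
    change tmk (T := RfBiset.id G) g (app φ s) =
      tmk (T := RfBiset.id G) (𝟙 x) (app φ (S.act (𝟙 z) g s))
    rw [app_act, ← e]
    simp)

/-- The bicategory of finite groupoids, right-free bisets and equivariant maps. -/
instance bicategory : Bicategory.{u, u + 1} BisetRf.{u} where
  homCategory H G := RfBiset.category H.gpd G.gpd
  whiskerLeft S _ _ φ := whiskerL S φ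
  whiskerRight φ T := whiskerR φ T
  associator S T U := assoc S T U
  leftUnitor S := leftUnit S
  rightUnitor S := rightUnit S
  whiskerLeft_id S T := comp_ext (fun _ _ _ _ _ => rfl)
  whiskerLeft_comp S _ _ _ φ ψ := comp_ext (fun _ _ _ _ _ => rfl)
  id_whiskerLeft φ := id_whiskerL φ
  comp_whiskerLeft S T _ _ φ := comp_ext₃ (fun _ _ _ _ _ _ _ => rfl)
  id_whiskerRight S T := comp_ext (fun _ _ _ _ _ => rfl)
  comp_whiskerRight φ ψ T := comp_ext (fun _ _ _ _ _ => rfl)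
  whiskerRight_id φ := whiskerR_id φ
  whiskerRight_comp φ T U := comp_ext₃' (fun _ _ _ _ _ _ _ => rfl)
  whisker_assoc S _ _ φ U := comp_ext₃ (fun _ _ _ _ _ _ _ => rfl)
  whisker_exchange φ ψ := comp_ext (fun _ _ _ _ _ => rfl)
  pentagon S T U V := comp_ext (fun w x y v a => by
    revert a
    refine tensor_ind (S := comp S T) (T := U) (fun z c a => ?_)
    revert a
    exact tensor_ind (S := S) (T := T) (fun z' t s => rfl))
  triangle S T := comp_ext₃ (fun w x y z t g s => by
    change tmk (T.act g (𝟙 x) t) s = tmk t (S.act (𝟙 w) g s)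
    exact tmk_act g t s)

end BisetRf

namespace Realization

open RfBiset

variable {L K H G F : FinGpd.{u}}

/-- The biset `R_!(i) = G(i-, -)` of a faithful functor `i : P ⥤ G`. -/
@[reducible]
def lower {P G : FinGpd.{u}} (i : P ⥤ G) (hi : i.Faithful) : RfBiset P G where
  functor := mkFunctor (fun z x => i.obj z ⟶ x) (fun p g s => i.map p ≫ s ≫ g) (by simp) (by simp)
  finite _ := inferInstance
  rightFree z x s p e := by
    have e : i.map p ≫ s ≫ 𝟙 x = s := e
    rw [Category.comp_id] at e
    apply i.map_injective
    rw [← cancel_mono s, e, CategoryTheory.Functor.map_id, Category.id_comp]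

/-- The biset `R^*(v) = H(-, v-)` of a functor `v : P ⥤ H`. -/
@[reducible]
def upper {P H : FinGpd.{u}} (v : P ⥤ H) : RfBiset H P where
  functor := mkFunctor (fun y z => y ⟶ v.obj z) (fun h p s => h ≫ s ≫ v.map p) (by simp) (by simp)
  finite _ := inferInstance
  rightFree y z s h e := by
    have e : h ≫ s ≫ v.map (𝟙 z) = s := e
    rw [CategoryTheory.Functor.map_id, Category.comp_id] at e
    rw [← cancel_mono s, e, Category.id_comp]

lemma lower_act {P G : FinGpd.{u}} (i : P ⥤ G) (hi : i.Faithful) {z z' : P} {x x' : G}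
    (p : z' ⟶ z) (g : x ⟶ x') (s : i.obj z ⟶ x) :
    (lower i hi).act p g s = i.map p ≫ s ≫ g := rfl

lemma upper_act {P H : FinGpd.{u}} (v : P ⥤ H) {y y' : H} {z z' : P}
    (h : y' ⟶ y) (p : z ⟶ z') (s : y ⟶ v.obj z) :
    (upper v).act h p s = h ≫ s ≫ v.map p := rfl

/-- The realization of a span `H ← P → G` (with legs `u`, `i`), which is the composite biset
`G(i-, -) ×_P H(-, u-)`. -/
@[reducible]
def real (X : RfSpan H G) : RfBiset H G :=
  comp (upper X.l) (lower X.r X.faithful)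

/-- The element `[g, h]` at `z` of the realization of a span. -/
@[reducible]
def elt (X : RfSpan H G) {y : H} {x : G} (z : X.apex) (g : X.r.obj z ⟶ x) (h : y ⟶ X.l.obj z) :
    (real X).El y x :=
  tmk (S := upper X.l) (T := lower X.r X.faithful) g h

lemma elt_act (X : RfSpan H G) {y y' : H} {x x' : G} (z : X.apex) (g : X.r.obj z ⟶ x)
    (h : y ⟶ X.l.obj z) (b : y' ⟶ y) (a : x ⟶ x') :
    (real X).act b a (elt X z g h) = elt X z (g ≫ a) (b ≫ h) := by
  change tmk _ _ = tmk _ _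
  simp [lower_act, upper_act]

lemma elt_map (X : RfSpan H G) {y : H} {x : G} {z z' : X.apex} (p : z ⟶ z')
    (g : X.r.obj z' ⟶ x) (h : y ⟶ X.l.obj z) :
    elt X z (X.r.map p ≫ g) h = elt X z' g (h ≫ X.l.map p) := by
  have e := tmk_act (S := upper X.l) (T := lower X.r X.faithful) p g h
  simpa [lower_act, upper_act] using e

lemma elt_ind (X : RfSpan H G) {y : H} {x : G} {P : (real X).El y x → Prop}
    (h : ∀ (z : X.apex) (a : X.r.obj z ⟶ x) (b : y ⟶ X.l.obj z), P (elt X z a b))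
    (a : (real X).El y x) : P a :=
  tensor_ind (S := upper X.l) (T := lower X.r X.faithful) h a

lemma real_ext {X : RfSpan H G} {U : RfBiset H G} {φ ψ : real X ⟶ U}
    (h : ∀ (y : H) (x : G) (z : X.apex) (a : X.r.obj z ⟶ x) (b : y ⟶ X.l.obj z),
      app φ (elt X z a b) = app ψ (elt X z a b)) : φ = ψ :=
  hom_ext (fun y x a => by
    induction a using elt_ind with
    | h z a b => exact h y x z a b)

/-- Build an equivariant map out of the realization of a span. -/
def realDesc {X : RfSpan H G} {U : RfBiset H G}
    (f : ∀ {y : H} {x : G} (z : X.apex), (X.r.obj z ⟶ x) → (y ⟶ X.l.obj z) → U.El y x)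
    (hf : ∀ {y : H} {x : G} {z z' : X.apex} (p : z ⟶ z') (g : X.r.obj z' ⟶ x)
      (h : y ⟶ X.l.obj z), f z (X.r.map p ≫ g) h = f z' g (h ≫ X.l.map p))
    (hf' : ∀ {y y' : H} {x x' : G} (b : y' ⟶ y) (a : x ⟶ x') (z : X.apex) (g : X.r.obj z ⟶ x)
      (h : y ⟶ X.l.obj z), f z (g ≫ a) (b ≫ h) = U.act b a (f z g h)) : real X ⟶ U :=
  compDesc (fun {y x z} g h => f z g h)
    (fun {y x z z'} p g h => by simpa [lower_act, upper_act] using hf p g h)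
    (fun {y y' x x' z} b a g h => by simpa [lower_act, upper_act] using hf' b a z g h)

@[simp]
lemma app_realDesc {X : RfSpan H G} {U : RfBiset H G}
    (f : ∀ {y : H} {x : G} (z : X.apex), (X.r.obj z ⟶ x) → (y ⟶ X.l.obj z) → U.El y x)
    (hf : ∀ {y : H} {x : G} {z z' : X.apex} (p : z ⟶ z') (g : X.r.obj z' ⟶ x)
      (h : y ⟶ X.l.obj z), f z (X.r.map p ≫ g) h = f z' g (h ≫ X.l.map p))
    (hf' : ∀ {y y' : H} {x x' : G} (b : y' ⟶ y) (a : x ⟶ x') (z : X.apex) (g : X.r.obj z ⟶ x)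
      (h : y ⟶ X.l.obj z), f z (g ≫ a) (b ≫ h) = U.act b a (f z g h))
    {y : H} {x : G} (z : X.apex) (g : X.r.obj z ⟶ x) (h : y ⟶ X.l.obj z) :
    app (realDesc f hf hf') (elt X z g h) = f z g h := rfl

/-- The map `[g, h] ↦ [β ≫ g, h ≫ α]` induced by a triple `(p, α, β)`. -/
def ofTriple {X Y : RfSpan H G} (t : SpanTriple X Y) : real X ⟶ real Y :=
  realDesc (fun z g h => elt Y (t.p.obj z) (t.β z ≫ g) (h ≫ t.α z))
    (fun p g h => by
      rw [← Category.assoc, ← t.β_nat, Category.assoc, elt_map, Category.assoc, Category.assoc,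
        t.α_nat])
    (fun b a z g h => by simp [elt_act])

/-- The realization of a 2-cell of spans. -/
def map₂ {X Y : RfSpan H G} (t : X ⟶ Y) : real X ⟶ real Y :=
  Quotient.lift ofTriple (fun s t h => by
    obtain ⟨c, h₁, h₂⟩ := h.exists_app
    refine real_ext (fun y x z a b => ?_)
    change elt Y _ (s.β z ≫ a) (b ≫ s.α z) = elt Y _ (t.β z ≫ a) (b ≫ t.α z)
    rw [← h₂, ← h₁, Category.assoc, elt_map, Category.assoc]) t

/-- The comparison `[g, h] ↦ g h` between the realization of an identity span and the identity. -/
def mapId (G : FinGpd.{u}) : real (RfSpan.id G) ≅ RfBiset.id G where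
  hom := realDesc (U := RfBiset.id G) (fun z g h => h ≫ g) (by simp) (by simp [id_act])
  inv := mkHom (fun {y x} s => elt (RfSpan.id G) y s (𝟙 y)) (fun {y y' x x'} h g s => by
    rw [elt_act, id_act]
    have e := elt_map (RfSpan.id G) h (s ≫ g) (𝟙 y')
    simpa using e)
  hom_inv_id := real_ext (fun y x z g h => by
    change elt (RfSpan.id G) y (h ≫ g) (𝟙 y) = elt (RfSpan.id G) z g h
    have e := elt_map (RfSpan.id G) h g (𝟙 y)
    simpa using e)
  inv_hom_id := hom_ext (fun y x (s : y ⟶ x) => by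
    change 𝟙 y ≫ s = s
    simp)

/-- The comparison `[g, h] ↦ [[g, θ], [1, h]]` at `(p, q, θ)` between the realization of a composite
span and the composite of the realizations. -/
def mapCompHom (X : RfSpan K H) (Y : RfSpan H G) :
    real (X.comp Y) ⟶ comp (real X) (real Y) :=
  realDesc
    (fun z g h => tmk (S := real X) (T := real Y)
      (elt Y z.right g z.hom) (elt X z.left (𝟙 (X.r.obj z.left)) h))
    (fun {y x z z'} p g h => by
      have e := elt_map X p.left (𝟙 _) h
      rw [Category.comp_id] at e
      rw [elt_map, ← p.w, ← e]
      have e₂ := tmk_act (S := real X) (T := real Y) (X.r.map p.left)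
        (elt Y z'.right g z'.hom) (elt X z.left (𝟙 (X.r.obj z.left)) h)
      rw [elt_act, elt_act] at e₂
      simpa using e₂)
    (fun b a z g h => by rw [comp_act, elt_act, elt_act]; simp)

lemma elt_congr (X : RfSpan K H) (Y : RfSpan H G) {z : K} {x : G} {p : X.apex} {q : Y.apex}
    {a b : X.r.obj p ⟶ Y.l.obj q} (e : a = b) (g : Y.r.obj q ⟶ x) (h : z ⟶ X.l.obj p) :
    elt (X.comp Y) (x := x) (y := z) { left := p, right := q, hom := a } g h =
      elt (X.comp Y) (x := x) (y := z) { left := p, right := q, hom := b } g h := by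
  subst e
  rfl

lemma elt_congr₃ (X : RfSpan L K) (Y : RfSpan K H) (Z : RfSpan H G) {w : L} {x : G} {p : X.apex}
    {q : Y.apex} {r : Z.apex} {a a' : Y.r.obj q ⟶ Z.l.obj r} (e : a = a')
    {b b' : X.r.obj p ⟶ Y.l.obj q} (e' : b = b') (g : Z.r.obj r ⟶ x) (h : w ⟶ X.l.obj p) :
    elt (X.comp (Y.comp Z)) (x := x) (y := w)
        { left := p, right := { left := q, right := r, hom := a }, hom := b } g h =
      elt (X.comp (Y.comp Z)) (x := x) (y := w)
        { left := p, right := { left := q, right := r, hom := a' }, hom := b' } g h := by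
  subst e e'
  rfl

/-- Descend a balanced map to the set of elements of a realization. -/
def eltLift {X : RfSpan H G} {y : H} {x : G} {A : Type u}
    (f : ∀ z : X.apex, (X.r.obj z ⟶ x) → (y ⟶ X.l.obj z) → A)
    (hf : ∀ {z z' : X.apex} (p : z ⟶ z') (g : X.r.obj z' ⟶ x) (h : y ⟶ X.l.obj z),
      f z (X.r.map p ≫ g) h = f z' g (h ≫ X.l.map p)) (a : (real X).El y x) : A :=
  tlift (S := upper X.l) (T := lower X.r X.faithful) (fun {z} g h => f z g h)
    (fun p g h => by simpa [lower_act, upper_act] using hf p g h) a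

@[simp]
lemma eltLift_elt {X : RfSpan H G} {y : H} {x : G} {A : Type u}
    (f : ∀ z : X.apex, (X.r.obj z ⟶ x) → (y ⟶ X.l.obj z) → A)
    (hf : ∀ {z z' : X.apex} (p : z ⟶ z') (g : X.r.obj z' ⟶ x) (h : y ⟶ X.l.obj z),
      f z (X.r.map p ≫ g) h = f z' g (h ≫ X.l.map p)) (z : X.apex) (g : X.r.obj z ⟶ x)
    (h : y ⟶ X.l.obj z) : eltLift f hf (elt X z g h) = f z g h := rfl

/-- The pairing `([g, k] at q, [m, h] at p) ↦ [g, h]` at `(p, q, k m)`. -/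
def pairing (X : RfSpan K H) (Y : RfSpan H G) {z : K} {y : H} {x : G} (b : (real Y).El y x)
    (a : (real X).El z y) : (real (X.comp Y)).El z x :=
  eltLift (fun q g k =>
    eltLift (fun p m h =>
      elt (X.comp Y) (x := x) (y := z) { left := p, right := q, hom := m ≫ k } g h)
      (fun {p p'} s m h => by
        have e := elt_map (X.comp Y) (x := x) (y := z)
          (z := { left := p, right := q, hom := (X.r.map s ≫ m) ≫ k })
          (z' := { left := p', right := q, hom := m ≫ k })
          { left := s, right := 𝟙 q } g h
        simpa using e) a)
    (fun {q q'} s g k => by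
      induction a using elt_ind with
      | h p m h =>
        have e := elt_map (X.comp Y) (x := x) (y := z)
          (z := { left := p, right := q, hom := m ≫ k })
          (z' := { left := p, right := q', hom := m ≫ k ≫ Y.l.map s })
          { left := 𝟙 p, right := s } g h
        simpa using e) b

lemma pairing_elt (X : RfSpan K H) (Y : RfSpan H G) {z : K} {y : H} {x : G} (q : Y.apex)
    (g : Y.r.obj q ⟶ x) (k : y ⟶ Y.l.obj q) (p : X.apex) (m : X.r.obj p ⟶ y)
    (h : z ⟶ X.l.obj p) :
    pairing X Y (elt Y q g k) (elt X p m h) =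
      elt (X.comp Y) (x := x) (y := z) { left := p, right := q, hom := m ≫ k } g h := rfl

/-- The inverse comparison, given by the pairing. -/
def mapCompInv (X : RfSpan K H) (Y : RfSpan H G) :
    comp (real X) (real Y) ⟶ real (X.comp Y) :=
  compDesc (S := real X) (T := real Y) (fun b a => pairing X Y b a)
    (fun s b a => by
      induction b using elt_ind with
      | h q g k =>
        induction a using elt_ind with
        | h p m h =>
          rw [elt_act, elt_act, pairing_elt, pairing_elt, Category.comp_id, Category.id_comp]
          exact elt_congr X Y (by simp) g h)
    (fun c d b a => by
      induction b using elt_ind with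
      | h q g k =>
        induction a using elt_ind with
        | h p m h =>
          rw [elt_act, elt_act, pairing_elt, pairing_elt, elt_act]
          exact elt_congr X Y (by simp) (g ≫ d) (c ≫ h))

lemma comp_real_ext {X : RfSpan K H} {Y : RfSpan H G} {U : RfBiset K G}
    {φ ψ : comp (real X) (real Y) ⟶ U}
    (e : ∀ (z : K) (x : G) (y : H) (q : Y.apex) (g : Y.r.obj q ⟶ x) (k : y ⟶ Y.l.obj q)
      (p : X.apex) (m : X.r.obj p ⟶ y) (h : z ⟶ X.l.obj p),
      app (y := z) (x := x) φ (tmk (S := real X) (T := real Y) (elt Y q g k) (elt X p m h)) =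
      app (y := z) (x := x) ψ (tmk (S := real X) (T := real Y) (elt Y q g k) (elt X p m h))) :
    φ = ψ :=
  comp_ext (fun z x y b a => by
    induction b using elt_ind with
    | h q g k =>
      induction a using elt_ind with
      | h p m h => exact e z x y q g k p m h)

/-- The compatibility of the realization with horizontal composition. -/
def mapComp (X : RfSpan K H) (Y : RfSpan H G) : real (X.comp Y) ≅ comp (real X) (real Y) where
  hom := mapCompHom X Y
  inv := mapCompInv X Y
  hom_inv_id := real_ext (fun y x z g h => by
    change elt (X.comp Y) (x := x) (y := y)
      { left := z.left, right := z.right, hom := 𝟙 _ ≫ z.hom } g h = elt (X.comp Y) z g h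
    exact elt_congr X Y (by simp) g h)
  inv_hom_id := comp_real_ext (fun z x y q g k p m h => by
    change tmk (S := real X) (T := real Y) (elt Y q g (m ≫ k)) (elt X p (𝟙 _) h) =
      tmk (S := real X) (T := real Y) (elt Y q g k) (elt X p m h)
    have e := tmk_act (S := real X) (T := real Y) m (elt Y q g k) (elt X p (𝟙 _) h)
    rw [elt_act, elt_act] at e
    simpa using e)

lemma map₂_id (X : RfSpan H G) : map₂ (𝟙 X) = 𝟙 (real X) :=
  real_ext (fun y x z g h => by
    change elt X z (𝟙 _ ≫ g) (h ≫ 𝟙 _) = elt X z g h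
    simp)

lemma map₂_comp {X Y Z : RfSpan H G} (s : X ⟶ Y) (t : Y ⟶ Z) :
    map₂ (s ≫ t) = map₂ s ≫ map₂ t := by
  obtain ⟨s⟩ := s
  obtain ⟨t⟩ := t
  refine real_ext (fun y x z g h => ?_)
  change elt Z (t.p.obj (s.p.obj z)) _ _ = elt Z (t.p.obj (s.p.obj z)) _ _
  simp

lemma map₂_whiskerL (X : RfSpan K H) {Y Y' : RfSpan H G} (t : Y ⟶ Y') :
    map₂ (SpanRf.whiskerL X t) =
      (mapComp X Y).hom ≫ BisetRf.whiskerL (real X) (map₂ t) ≫ (mapComp X Y').inv := by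
  obtain ⟨t⟩ := t
  refine real_ext (fun y x z g h => ?_)
  change elt (X.comp Y') (x := x) (y := y)
      { left := z.left, right := t.p.obj z.right, hom := z.hom ≫ t.α z.right }
      (t.β z.right ≫ g) (h ≫ 𝟙 _) =
    elt (X.comp Y') (x := x) (y := y)
      { left := z.left, right := t.p.obj z.right, hom := 𝟙 _ ≫ z.hom ≫ t.α z.right }
      (t.β z.right ≫ g) h
  rw [Category.comp_id]
  exact elt_congr X Y' (by simp) (t.β z.right ≫ g) h

lemma map₂_whiskerR {X X' : RfSpan K H} (t : X ⟶ X') (Y : RfSpan H G) :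
    map₂ (SpanRf.whiskerR t Y) =
      (mapComp X Y).hom ≫ BisetRf.whiskerR (map₂ t) (real Y) ≫ (mapComp X' Y).inv := by
  obtain ⟨t⟩ := t
  refine real_ext (fun y x z g h => ?_)
  change elt (X'.comp Y) (x := x) (y := y)
      { left := t.p.obj z.left, right := z.right, hom := t.β z.left ≫ z.hom }
      (𝟙 _ ≫ g) (h ≫ t.α z.left) =
    elt (X'.comp Y) (x := x) (y := y)
      { left := t.p.obj z.left, right := z.right, hom := (t.β z.left ≫ 𝟙 _) ≫ z.hom }
      g (h ≫ t.α z.left)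
  rw [Category.id_comp]
  exact elt_congr X' Y (by simp) g (h ≫ t.α z.left)

lemma map₂_assoc (X : RfSpan L K) (Y : RfSpan K H) (Z : RfSpan H G) :
    map₂ (SpanRf.assoc X Y Z).hom = (mapComp (X.comp Y) Z).hom ≫
      BisetRf.whiskerR (mapComp X Y).hom (real Z) ≫
      (BisetRf.assoc (real X) (real Y) (real Z)).hom ≫
      BisetRf.whiskerL (real X) (mapComp Y Z).inv ≫ (mapComp X (Y.comp Z)).inv := by
  refine real_ext (fun y x z g h => ?_)
  change elt (X.comp (Y.comp Z)) (x := x) (y := y)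
      { left := z.left.left
        right := { left := z.left.right, right := z.right, hom := z.hom }
        hom := z.left.hom } (𝟙 _ ≫ g) (h ≫ 𝟙 _) =
    elt (X.comp (Y.comp Z)) (x := x) (y := y)
      { left := z.left.left
        right := { left := z.left.right, right := z.right, hom := 𝟙 _ ≫ z.hom }
        hom := 𝟙 _ ≫ z.left.hom } g h
  rw [Category.comp_id, Category.id_comp]
  exact elt_congr₃ X Y Z (by simp) (by simp) g h

lemma map₂_leftUnit (X : RfSpan H G) :
    map₂ (SpanRf.leftUnit X).hom = (mapComp (RfSpan.id H) X).hom ≫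
      BisetRf.whiskerR (mapId H).hom (real X) ≫ (BisetRf.leftUnit (real X)).hom := by
  refine real_ext (fun y x z g h => ?_)
  change elt X z.right (𝟙 _ ≫ g) (h ≫ z.hom) =
    (real X).act (h ≫ 𝟙 _) (𝟙 x) (elt X z.right g z.hom)
  rw [elt_act]
  simp

lemma map₂_rightUnit (X : RfSpan H G) :
    map₂ (SpanRf.rightUnit X).hom = (mapComp X (RfSpan.id G)).hom ≫
      BisetRf.whiskerL (real X) (mapId G).hom ≫ (BisetRf.rightUnit (real X)).hom := by
  refine real_ext (fun y x z g h => ?_)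
  change elt X z.left (z.hom ≫ g) (h ≫ 𝟙 _) =
    (real X).act (𝟙 y) (z.hom ≫ g) (elt X z.left (𝟙 _) h)
  rw [elt_act]
  simp

end Realization

/-- The realization pseudo-functor: it is the identity on objects and sends a span
`H ← P → G` with legs `u`, `i` to the biset `G(i-, -) ×_P H(-, u-)`. -/
def realization : Pseudofunctor SpanRf.{u} BisetRf.{u} where
  obj G := ⟨G.gpd⟩
  map X := Realization.real X
  map₂ t := Realization.map₂ t
  map₂_id X := Realization.map₂_id X
  map₂_comp s t := Realization.map₂_comp s t
  mapId G := Realization.mapId G.gpd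
  mapComp X Y := Realization.mapComp X Y
  map₂_whisker_left X _ _ t := Realization.map₂_whiskerL X t
  map₂_whisker_right t Y := Realization.map₂_whiskerR t Y
  map₂_associator X Y Z := Realization.map₂_assoc X Y Z
  map₂_left_unitor X := Realization.map₂_leftUnit X
  map₂_right_unitor X := Realization.map₂_rightUnit X

namespace Grothendieck

open RfBiset

variable {L K H G F : FinGpd.{u}}

/-- The objects of `∫ S`: triples `(y, x, s)` with `s ∈ S(y, x)`. -/
structure Obj (S : RfBiset H G) : Type u where
  y : H
  x : G
  s : S.El y x

/-- The morphisms `(y, x, s) ⟶ (y', x', s')` of `∫ S`: pairs `(h, g)` with `g · s = s' · h`. -/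
@[ext]
structure Hom {S : RfBiset H G} (a b : Obj S) : Type u where
  h : a.y ⟶ b.y
  g : a.x ⟶ b.x
  w : S.act (𝟙 a.y) g a.s = S.act h (𝟙 b.x) b.s

lemma comp_w {S : RfBiset H G} {a b c : Obj S} (f : Hom a b) (k : Hom b c) :
    S.act (𝟙 a.y) (f.g ≫ k.g) a.s = S.act (f.h ≫ k.h) (𝟙 c.x) c.s := by
  have e₁ := congrArg (S.act (𝟙 a.y) k.g) f.w
  have e₂ := congrArg (S.act f.h (𝟙 c.x)) k.w
  simp only [act_act, Category.comp_id, Category.id_comp] at e₁ e₂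
  rw [e₁, e₂]

lemma inv_w {S : RfBiset H G} {a b : Obj S} (f : Hom a b) :
    S.act (𝟙 b.y) (Groupoid.inv f.g) b.s = S.act (Groupoid.inv f.h) (𝟙 a.x) a.s := by
  have e := congrArg (S.act (Groupoid.inv f.h) (Groupoid.inv f.g)) f.w
  simp only [act_act, Category.comp_id, Category.id_comp, Groupoid.comp_inv, Groupoid.inv_comp] at e
  exact e.symm

/-- The groupoid `∫ S`. -/
instance groupoid (S : RfBiset H G) : Groupoid.{u} (Obj S) where
  Hom a b := Hom a b
  id a := { h := 𝟙 a.y, g := 𝟙 a.x, w := rfl }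
  comp f k := { h := f.h ≫ k.h, g := f.g ≫ k.g, w := comp_w f k }
  id_comp f := Hom.ext (Category.id_comp _) (Category.id_comp _)
  comp_id f := Hom.ext (Category.comp_id _) (Category.comp_id _)
  assoc f k l := Hom.ext (Category.assoc _ _ _) (Category.assoc _ _ _)
  inv f := { h := Groupoid.inv f.h, g := Groupoid.inv f.g, w := inv_w f }
  inv_comp f := Hom.ext (Groupoid.inv_comp f.h) (Groupoid.inv_comp f.g)
  comp_inv f := Hom.ext (Groupoid.comp_inv f.h) (Groupoid.comp_inv f.g)

/-- The finite groupoid `∫ S`. -/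
@[reducible]
def total (S : RfBiset H G) : FinGpd.{u} where
  carrier := Obj S
  grpd := groupoid S
  finiteObj := Finite.of_injective
    (fun a : Obj S => (⟨a.y, a.x, a.s⟩ : Σ (y : H) (x : G), S.El y x)) (by
      rintro ⟨y, x, s⟩ ⟨y', x', s'⟩ h
      simp only [Sigma.mk.injEq] at h
      obtain ⟨rfl, h⟩ := h
      simp only [heq_eq_eq, Sigma.mk.injEq] at h
      obtain ⟨rfl, h⟩ := h
      simp only [heq_eq_eq] at h
      rw [h])
  finiteHom a b := Finite.of_injective
    (fun f : Hom a b => ((f.h, f.g) : (a.y ⟶ b.y) × (a.x ⟶ b.x))) (by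
      intro f k e
      simp only [Prod.mk.injEq] at e
      exact Hom.ext e.1 e.2)

/-- The Grothendieck construction of a right-free biset `S`: the span `H ← ∫ S → G` given by the
two projections. -/
@[reducible]
def span (S : RfBiset H G) : RfSpan H G where
  apex := total S
  l :=
    { obj := fun a => a.y
      map := fun f => f.h
      map_id := fun _ => rfl
      map_comp := fun _ _ => rfl }
  r :=
    { obj := fun a => a.x
      map := fun f => f.g
      map_id := fun _ => rfl
      map_comp := fun _ _ => rfl }
  faithful :=
    { map_injective := fun {a b} f k (e : f.g = k.g) => by
        refine Hom.ext ?_ e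
        have e₁ : S.act f.h (𝟙 b.x) b.s = S.act k.h (𝟙 b.x) b.s := by rw [← f.w, ← k.w, e]
        have e₂ := congrArg (S.act (CategoryTheory.inv k.h) (𝟙 b.x)) e₁
        simp only [act_act, Category.comp_id, IsIso.inv_hom_id, act_id] at e₂
        have e₃ := S.free b.s _ e₂
        rwa [IsIso.inv_comp_eq, Category.comp_id] at e₃ }

/-- The triple `(∫ φ, id, id)`, where `∫ φ` sends `(y, x, s)` to `(y, x, φ s)` and `(h, g)` to
`(h, g)`. -/
@[reducible]
def triple {S T : RfBiset H G} (φ : S ⟶ T) : SpanTriple (span S) (span T) where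
  p :=
    { obj := fun a => { y := a.y, x := a.x, s := app φ a.s }
      map := fun f => { h := f.h, g := f.g, w := by rw [← app_act, f.w, app_act] }
      map_id := fun _ => rfl
      map_comp := fun _ _ => rfl }
  α := fun a => 𝟙 a.y
  α_nat := by simp
  β := fun a => 𝟙 a.x
  β_nat := by simp

/-- The comparison from the identity span to `∫ G(-,-)`, sending `x` to `(x, x, id)`. -/
@[reducible]
def unitTriple (G : FinGpd.{u}) : SpanTriple (RfSpan.id G) (span (RfBiset.id G)) where
  p :=
    { obj := fun x => { y := x, x := x, s := 𝟙 x }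
      map := fun f => { h := f, g := f, w := by simp [id_act] }
      map_id := fun _ => rfl
      map_comp := fun _ _ => rfl }
  α := fun x => 𝟙 x
  α_nat := by simp
  β := fun x => 𝟙 x
  β_nat := by simp

/-- The comparison from the composite of `∫ S` and `∫ T` to `∫ (T ×_H S)`, sending
`((z, y, s), (y', x, t), θ : y ≅ y')` to `(z, x, [t · θ, s])`. -/
@[reducible]
def compTriple (S : RfBiset K H) (T : RfBiset H G) :
    SpanTriple ((span S).comp (span T)) (span (comp S T)) where
  p :=
    { obj := fun z =>
        { y := z.left.y
          x := z.right.x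
          s := tmk (S := S) (T := T) (T.act z.hom (𝟙 z.right.x) z.right.s) z.left.s }
      map := fun {z z'} f =>
        { h := f.left.h
          g := f.right.g
          w := by
            rw [comp_act, comp_act]
            have e₁ := congrArg (T.act z.hom (𝟙 z'.right.x)) f.right.w
            have e₂ : f.left.g ≫ z'.hom = z.hom ≫ f.right.h := f.w
            have e₃ := tmk_act (S := S) (T := T) f.left.g
              (T.act z'.hom (𝟙 z'.right.x) z'.right.s) z.left.s
            rw [f.left.w] at e₃
            simp only [act_act, Category.comp_id, Category.id_comp, act_id] at e₁ e₃ ⊢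
            rw [e₁, ← e₂, e₃] }
      map_id := fun _ => rfl
      map_comp := fun _ _ => rfl }
  α := fun z => 𝟙 z.left.y
  α_nat := by simp
  β := fun z => 𝟙 z.right.x
  β_nat := by simp

lemma map₂_id (S : RfBiset H G) : (triple (𝟙 S)).toHom = 𝟙 (span S) :=
  SpanTriple.sound (fun z => { h := 𝟙 z.y, g := 𝟙 z.x, w := by simp })
    (fun z => by simp) (fun z => by simp)

lemma map₂_comp {S T U : RfBiset H G} (φ : S ⟶ T) (ψ : T ⟶ U) :
    (triple (φ ≫ ψ)).toHom = (triple φ).toHom ≫ (triple ψ).toHom :=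
  SpanTriple.sound (fun z => { h := 𝟙 z.y, g := 𝟙 z.x, w := by simp })
    (fun z => by simp) (fun z => by simp)

lemma nat_left {S S' : RfBiset K H} (φ : S ⟶ S') (T : RfBiset H G) :
    (compTriple S T).toHom ≫ (triple (BisetRf.whiskerR φ T)).toHom =
      SpanRf.whiskerR (triple φ).toHom (span T) ≫ (compTriple S' T).toHom :=
  SpanTriple.sound (fun z => { h := 𝟙 z.left.y, g := 𝟙 z.right.x, w := by simp })
    (fun z => by simp) (fun z => by simp)

lemma nat_right (S : RfBiset K H) {T T' : RfBiset H G} (φ : T ⟶ T') :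
    (compTriple S T).toHom ≫ (triple (BisetRf.whiskerL S φ)).toHom =
      SpanRf.whiskerL (span S) (triple φ).toHom ≫ (compTriple S T').toHom :=
  SpanTriple.sound (fun z => { h := 𝟙 z.left.y, g := 𝟙 z.right.x, w := by simp [app_act] })
    (fun z => by simp) (fun z => by simp)

lemma lax_assoc (S : RfBiset L K) (T : RfBiset K H) (U : RfBiset H G) :
    SpanRf.whiskerR (compTriple S T).toHom (span U) ≫ (compTriple (comp S T) U).toHom ≫
        (triple (BisetRf.assoc S T U).hom).toHom =
      (SpanRf.assoc (span S) (span T) (span U)).hom ≫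
        SpanRf.whiskerL (span S) (compTriple T U).toHom ≫ (compTriple S (comp T U)).toHom :=
  SpanTriple.sound (fun z => {
      h := 𝟙 z.left.left.y
      g := 𝟙 z.right.x
      w := by
        simp
        change tmk (T := comp T U) (tmk _ (T.act _ _ _) : Tensor T U _ _) _ =
          tmk (T := comp T U) (tmk (U.act _ _ _) (T.act _ _ _) : Tensor T U _ _) _
        simp })
    (fun z => by simp) (fun z => by simp)

lemma lax_leftUnit (S : RfBiset H G) :
    (triple (BisetRf.leftUnit S).inv).toHom = (SpanRf.leftUnit (span S)).inv ≫
      SpanRf.whiskerR (unitTriple H).toHom (span S) ≫ (compTriple (RfBiset.id H) S).toHom :=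
  SpanTriple.sound (fun z => {
      h := 𝟙 z.y
      g := 𝟙 z.x
      w := by
        simp
        rfl })
    (fun z => by simp) (fun z => by simp)

lemma lax_rightUnit (S : RfBiset H G) :
    (triple (BisetRf.rightUnit S).inv).toHom = (SpanRf.rightUnit (span S)).inv ≫
      SpanRf.whiskerL (span S) (unitTriple G).toHom ≫ (compTriple S (RfBiset.id G)).toHom :=
  SpanTriple.sound (fun z => {
      h := 𝟙 z.y
      g := 𝟙 z.x
      w := by
        simp
        rfl })
    (fun z => by simp) (fun z => by simp)

end Grothendieck

/-- The Grothendieck construction as a lax functor (it is a pseudo-functor precisely when its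
comparison 2-cells are invertible): it is the identity on objects, sends a biset `S` to the span
`H ← ∫ S → G` and an equivariant map `φ` to the class `[∫ φ, id, id]`. -/
def grothendieckLax : LaxFunctor BisetRf.{u} SpanRf.{u} where
  obj G := ⟨G.gpd⟩
  map S := Grothendieck.span S
  map₂ φ := (Grothendieck.triple φ).toHom
  map₂_id S := Grothendieck.map₂_id S
  map₂_comp φ ψ := Grothendieck.map₂_comp φ ψ
  mapId G := (Grothendieck.unitTriple G.gpd).toHom
  mapComp S T := (Grothendieck.compTriple S T).toHom
  mapComp_naturality_left φ T := Grothendieck.nat_left φ T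
  mapComp_naturality_right S _ _ φ := Grothendieck.nat_right S φ
  map₂_associator S T U := Grothendieck.lax_assoc S T U
  map₂_leftUnitor S := Grothendieck.lax_leftUnit S
  map₂_rightUnitor S := Grothendieck.lax_rightUnit S


open scoped CategoryTheory.Pseudofunctor.StrongTrans

/-! Both pseudo-functors fix the objects, so no object of either bicategory has to be transported.
It is enough to compare 1-cells by invertible 2-cells that respect 2-cells, identities and
composites. Such a family is an invertible icon, and padding its 2-cells with identity 1-cells turns
it into a pseudo-natural equivalence (`Icon.equivalence`).

For a biset `S`, the 2-cell `realSpan` is the evaluation `[g, h] ↦ g · s · h` at `(y, x, s)`. It is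
balanced because of the equation that defines the morphisms of `∫ S`, and its inverse sends `s` to
`[1, 1]` at `(y, x, s)`.

For a span `X`, the 2-cell `unitSpan` sends `z` to `(l z, r z, [1, 1])`. Its inverse needs choices,
and so do the inverses of the structure 2-cells of `∫`. All three are obtained from one criterion,
`SpanTriple.isIso_toHom`: a class `[p, α, β]` is invertible as soon as `p` is full and essentially
surjective. Faithfulness of `p` follows from that of the right leg of the source, and a
quasi-inverse functor of `p` carries the two natural isomorphisms along.

Fullness always comes from the same source. A morphism of `∫` of a tensor product is an equation
between classes `[t, s]`; since the middle term is a groupoid, two pairs are identified only if a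
single morphism relates them. That morphism is the missing component of the preimage
(`isIso_compTriple`, `isIso_unitSpan`).

The remaining work is to check the icon laws. On bisets they are equations between elements of a
tensor product. On spans they are equations between isomorphism classes, settled by a family of
morphisms whose naturality is automatic by faithfulness of the right leg. -/

namespace CategoryTheory.Bicategory

universe w₁ w₂ v₁ v₂ u₁ u₂

/-! ### Padding 2-isomorphisms with identity 1-cells -/

section Conjugation

variable {C : Type u₂} [Bicategory.{w₂, v₂} C]

/-- A 2-isomorphism, padded with identity 1-cells. -/
@[simps!]
def padIso {x y : C} {f g : x ⟶ y} (α : f ≅ g) : f ≫ 𝟙 y ≅ 𝟙 x ≫ g :=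
  ρ_ f ≪≫ α ≪≫ (λ_ g).symm

/-- This lemma and the next two turn the three icon laws into the three axioms of a pseudo-natural
transformation with identity components; beyond the hypothesis `h`, only unitor coherence is
involved. -/
lemma pad_naturality {x y : C} {f f' g g' : x ⟶ y} {φ : f ⟶ f'} {γ : g ⟶ g'} {α : f ≅ g}
    {α' : f' ≅ g'} (h : φ ≫ α'.hom = α.hom ≫ γ) :
    φ ▷ 𝟙 y ≫ (padIso α').hom = (padIso α).hom ≫ 𝟙 x ◁ γ := by
  simp [reassoc_of% h]

lemma pad_id {x : C} {f g : x ⟶ x} {i : f ≅ 𝟙 x} {j : g ≅ 𝟙 x} {α : f ≅ g}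
    (h : i.inv ≫ α.hom = j.inv) :
    (padIso α).hom ≫ 𝟙 x ◁ j.hom = i.hom ▷ 𝟙 x ≫ (λ_ (𝟙 x)).hom ≫ (ρ_ (𝟙 x)).inv := by
  rw [Iso.inv_comp_eq] at h
  simp [h, unitors_equal, unitors_inv_equal]

lemma pad_comp {x y z : C} {f₁ g₁ : x ⟶ y} {f₂ g₂ : y ⟶ z} {f g : x ⟶ z} {i : f ≅ f₁ ≫ f₂}
    {j : g ≅ g₁ ≫ g₂} {α₁ : f₁ ≅ g₁} {α₂ : f₂ ≅ g₂} {α : f ≅ g}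
    (h : i.inv ≫ α.hom = f₁ ◁ α₂.hom ≫ α₁.hom ▷ g₂ ≫ j.inv) :
    (padIso α).hom ≫ 𝟙 x ◁ j.hom =
      i.hom ▷ 𝟙 z ≫ (α_ _ _ _).hom ≫ f₁ ◁ (padIso α₂).hom ≫ (α_ _ _ _).inv ≫
        (padIso α₁).hom ▷ g₂ ≫ (α_ _ _ _).hom := by
  rw [Iso.inv_comp_eq] at h
  simp [h]

/-- This is the modification axiom for the unit of the equivalence attached to an icon. The 2-cells
`α` and `α⁻¹` meet and cancel, and what is left is coherence of unitors and associators. -/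
lemma pad_pad {x y : C} {f g : x ⟶ y} (α : f ≅ g) :
    f ◁ (λ_ (𝟙 y)).inv ≫ (α_ _ _ _).inv ≫ (padIso α).hom ▷ 𝟙 y ≫ (α_ _ _ _).hom ≫
        𝟙 x ◁ (padIso α.symm).hom ≫ (α_ _ _ _).inv =
      ((ρ_ f).hom ≫ (λ_ f).inv) ≫ (λ_ (𝟙 x)).inv ▷ f := by
  simp only [padIso_hom, Iso.symm_hom]
  simp
  bicategory

end Conjugation

/-! ### Pseudo-functors with a fixed object map, and invertible icons -/

variable {B : Type u₁} [Bicategory.{w₁, v₁} B] {C : Type u₂} [Bicategory.{w₂, v₂} C]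

/-- A pseudofunctor whose action on objects is a given function. -/
structure PseudoOver (o : B → C) where
  map {a b : B} (f : a ⟶ b) : o a ⟶ o b
  map₂ {a b : B} {f g : a ⟶ b} (η : f ⟶ g) : map f ⟶ map g
  map₂_id {a b : B} (f : a ⟶ b) : map₂ (𝟙 f) = 𝟙 (map f)
  map₂_comp {a b : B} {f g h : a ⟶ b} (η : f ⟶ g) (θ : g ⟶ h) :
    map₂ (η ≫ θ) = map₂ η ≫ map₂ θ
  mapId (a : B) : map (𝟙 a) ≅ 𝟙 (o a)
  mapComp {a b c : B} (f : a ⟶ b) (g : b ⟶ c) : map (f ≫ g) ≅ map f ≫ map g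
  map₂_whisker_left {a b c : B} (f : a ⟶ b) {g h : b ⟶ c} (η : g ⟶ h) :
    map₂ (f ◁ η) = (mapComp f g).hom ≫ map f ◁ map₂ η ≫ (mapComp f h).inv
  map₂_whisker_right {a b c : B} {f g : a ⟶ b} (η : f ⟶ g) (h : b ⟶ c) :
    map₂ (η ▷ h) = (mapComp f h).hom ≫ map₂ η ▷ map h ≫ (mapComp g h).inv
  map₂_associator {a b c d : B} (f : a ⟶ b) (g : b ⟶ c) (h : c ⟶ d) :
    map₂ (α_ f g h).hom = (mapComp (f ≫ g) h).hom ≫ (mapComp f g).hom ▷ map h ≫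
      (α_ (map f) (map g) (map h)).hom ≫ map f ◁ (mapComp g h).inv ≫ (mapComp f (g ≫ h)).inv
  map₂_left_unitor {a b : B} (f : a ⟶ b) :
    map₂ (λ_ f).hom = (mapComp (𝟙 a) f).hom ≫ (mapId a).hom ▷ map f ≫ (λ_ (map f)).hom
  map₂_right_unitor {a b : B} (f : a ⟶ b) :
    map₂ (ρ_ f).hom = (mapComp f (𝟙 b)).hom ≫ map f ◁ (mapId b).hom ≫ (ρ_ (map f)).hom

namespace PseudoOver

/-- A pseudofunctor, seen over its action on objects. -/
@[reducible]
def of (F : Pseudofunctor B C) : PseudoOver F.obj where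
  map f := F.map f
  map₂ η := F.map₂ η
  map₂_id := F.map₂_id
  map₂_comp := F.map₂_comp
  mapId := F.mapId
  mapComp f g := F.mapComp f g
  map₂_whisker_left := F.map₂_whisker_left
  map₂_whisker_right := F.map₂_whisker_right
  map₂_associator := F.map₂_associator
  map₂_left_unitor := F.map₂_left_unitor
  map₂_right_unitor := F.map₂_right_unitor

variable {o : B → C}

/-- The underlying pseudofunctor. -/
@[reducible]
def toPseudofunctor (F : PseudoOver o) : Pseudofunctor B C where
  obj := o
  map := F.map
  map₂ := F.map₂
  map₂_id := F.map₂_id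
  map₂_comp := F.map₂_comp
  mapId := F.mapId
  mapComp := F.mapComp
  map₂_whisker_left := F.map₂_whisker_left
  map₂_whisker_right := F.map₂_whisker_right
  map₂_associator := F.map₂_associator
  map₂_left_unitor := F.map₂_left_unitor
  map₂_right_unitor := F.map₂_right_unitor

/-- An invertible icon: an identity-component pseudo-natural isomorphism between two pseudofunctors
that agree on objects. -/
structure Icon (F G : PseudoOver o) where
  iso {a b : B} (f : a ⟶ b) : F.map f ≅ G.map f
  naturality {a b : B} {f g : a ⟶ b} (η : f ⟶ g) :
    F.map₂ η ≫ (iso g).hom = (iso f).hom ≫ G.map₂ η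
  map_id (a : B) : (F.mapId a).inv ≫ (iso (𝟙 a)).hom = (G.mapId a).inv
  map_comp {a b c : B} (f : a ⟶ b) (g : b ⟶ c) :
    (F.mapComp f g).inv ≫ (iso (f ≫ g)).hom =
      F.map f ◁ (iso g).hom ≫ (iso f).hom ▷ G.map g ≫ (G.mapComp f g).inv

namespace Icon

variable {F G : PseudoOver o}

/-- The inverse of an invertible icon. -/
@[simps iso]
def symm (α : Icon F G) : Icon G F where
  iso f := (α.iso f).symm
  naturality η := by simp [Iso.eq_inv_comp, ← reassoc_of% (α.naturality η)]
  map_id a := by simp [← α.map_id]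
  map_comp f g := by
    rw [Iso.symm_hom, Iso.comp_inv_eq, Category.assoc, Category.assoc, α.map_comp]
    -- Interchange moves the component at `f` past the one at `g`, after which each meets its
    -- inverse.
    simp [← whisker_exchange_assoc]

/-- The pseudo-natural transformation with identity components given by an icon. -/
@[reducible]
def trans (α : Icon F G) : F.toPseudofunctor ⟶ G.toPseudofunctor where
  app a := 𝟙 (o a)
  naturality f := padIso (α.iso f)
  naturality_naturality η := pad_naturality (α.naturality η)
  naturality_id a := pad_id (α.map_id a)
  naturality_comp f g := pad_comp (α.map_comp f g)

/-- The composite of an icon with its inverse is isomorphic to the identity. -/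
def unit (α : Icon F G) : 𝟙 F.toPseudofunctor ≅ α.trans ≫ α.symm.trans :=
  Pseudofunctor.StrongTrans.isoMk (fun a => (λ_ (𝟙 (o a))).symm) (fun f => pad_pad (α.iso f))

/-- An invertible icon is an equivalence of pseudofunctors. -/
def equivalence (α : Icon F G) : Equivalence F.toPseudofunctor G.toPseudofunctor :=
  -- The inverse of `α.symm` is `α` by definition, so the unit of `α.symm`, reversed, has the type
  -- of a counit. Adjointification corrects it, so no triangle identity has to be checked.
  Equivalence.mkOfAdjointifyCounit α.unit α.symm.unit.symm

end Icon

end PseudoOver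

end CategoryTheory.Bicategory

/-! ### A criterion for invertibility of 2-cells of spans -/

namespace SpanTriple

variable {H G : FinGpd.{u}} {X Y : RfSpan H G}

/-- A quasi-inverse of a triple `(p, α, β)`, given lifts of morphisms along the faithful functor `p`
and an essential preimage of every object. -/
@[reducible]
noncomputable def quasiInverse (t : SpanTriple X Y) [t.p.Faithful]
    (lift : ∀ {z w : X.apex}, (t.p.obj z ⟶ t.p.obj w) → (z ⟶ w))
    (map_lift : ∀ {z w : X.apex} (k : t.p.obj z ⟶ t.p.obj w), t.p.map (lift k) = k)
    (q : Y.apex → X.apex) (ε : ∀ w, t.p.obj (q w) ⟶ w) : SpanTriple Y X where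
  p :=
    { obj := q
      -- Conjugation by `ε` gives a morphism between objects in the image of `p`. Its lift is unique
      -- by faithfulness, which makes the assignment functorial.
      map := fun {w w'} f => lift (ε w ≫ f ≫ inv (ε w'))
      map_id := fun w => t.p.map_injective (by simp [map_lift])
      map_comp := fun f g => t.p.map_injective (by simp [map_lift]) }
  α w := Y.l.map (inv (ε w)) ≫ inv (t.α (q w))
  α_nat {w w'} f := by
    have e := t.α_nat (lift (ε w ≫ f ≫ inv (ε w')))
    rw [← cancel_mono (t.α (q w')), Category.assoc, Category.assoc, Category.assoc, e, map_lift]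
    simp
  β w := inv (t.β (q w)) ≫ Y.r.map (ε w)
  β_nat {w w'} f := by
    have e := t.β_nat (lift (ε w ≫ f ≫ inv (ε w')))
    rw [← cancel_epi (t.β (q w)), ← reassoc_of% e, map_lift]
    simp

/-- A morphism of spans is invertible as soon as its underlying functor is full and essentially
surjective: it is automatically faithful, as the right leg of the source is. -/
lemma isIso_toHom (t : SpanTriple X Y)
    (full : ∀ {z w : X.apex} (k : t.p.obj z ⟶ t.p.obj w), ∃ f, t.p.map f = k)
    (surj : ∀ w : Y.apex, ∃ z, Nonempty (t.p.obj z ⟶ w)) : IsIso t.toHom := by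
  -- The isomorphism `β` conjugates the right leg of `Y` after `p` into the faithful right leg of
  -- `X`.
  have : t.p.Faithful := ⟨fun {z w} f g e => by
    have := X.faithful
    apply X.r.map_injective
    rw [← cancel_epi (t.β z), ← t.β_nat, ← t.β_nat, e]⟩
  choose lift map_lift using @full
  choose q ε using surj
  -- The two composites are compared with the identities through the lift of `ε` at `p z` and
  -- through `ε` itself. Only compatibility with the legs remains to be verified; naturality is
  -- supplied by `sound`.
  refine ⟨(t.quasiInverse (fun k => lift k) (fun k => map_lift k) q
      (fun w => Classical.choice (ε w))).toHom,
    sound (fun z => lift (Classical.choice (ε (t.p.obj z)))) (fun z => ?_) (fun z => ?_),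
    sound (fun w => Classical.choice (ε w)) (fun w => ?_) (fun w => ?_)⟩
  · have e := t.α_nat (lift (Classical.choice (ε (t.p.obj z))))
    rw [← cancel_mono (t.α z), Category.assoc, e, map_lift]
    simp
  · have e := t.β_nat (lift (Classical.choice (ε (t.p.obj z))))
    rw [map_lift] at e
    simp [e]
  · simp
  · simp

end SpanTriple

/-! ### Invertibility of the structure 2-cells of `∫` -/

namespace Grothendieck

open RfBiset

variable {K H G : FinGpd.{u}}

/-- Between objects `(z, z, 1)` and `(w, w, 1)` the condition on a pair `(h, g)` reads `h = g`,
which gives fullness. An arbitrary `(y, x, s)` is reached from `(y, y, 1)` by the morphism `(1, s)`.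
-/
lemma isIso_unitTriple (G : FinGpd.{u}) : IsIso (unitTriple G).toHom := by
  refine SpanTriple.isIso_toHom _ (fun {z w} k => ⟨k.h, ?_⟩) (fun w => ⟨w.y, ⟨?_⟩⟩)
  · have e : k.h ≫ 𝟙 w ≫ 𝟙 w = 𝟙 z ≫ 𝟙 z ≫ k.g := k.w.symm
    exact Hom.ext rfl (by simpa using e)
  · exact { h := 𝟙 w.y, g := w.s, w := by simp [id_act] }

/-- Fullness amounts to unpacking an equality of classes in the tensor product. For essential
surjectivity, `(z, x, [t, s])` is isomorphic, by identity components, to the image of the pair `(z,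
y, s)`, `(y, x, t)` with `θ = 1`. -/
lemma isIso_compTriple (S : RfBiset K H) (T : RfBiset H G) : IsIso (compTriple S T).toHom := by
  refine SpanTriple.isIso_toHom _ (fun {z w} k => ?_) (fun w => ?_)
  · have e := k.w
    dsimp only at e
    rw [comp_act, comp_act, tmk_eq_iff] at e
    obtain ⟨c, h₁, h₂⟩ := e
    simp only [act_act, Category.comp_id, Category.id_comp] at h₁ h₂
    -- The morphism `c` of `H` that identifies the two representatives becomes the inner component
    -- on the `S` side. Compatibility with the isomorphisms `θ` then forces the inner component on
    -- the `T` side to be `θ⁻¹` followed by `c` and `θ'`.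
    refine ⟨{ left := { h := k.h, g := c, w := h₂ }
              right := { h := inv z.hom ≫ c ≫ w.hom, g := k.g, w := ?_ }
              w := ?_ }, rfl⟩
    · have e := congrArg (T.act (inv z.hom) (𝟙 _)) h₁
      simpa using e
    · simp
  · obtain ⟨z, x, a⟩ := w
    induction a using tensor_ind with
    | h y t s =>
      exact ⟨{ left := { y := z, x := y, s := s }, right := { y := y, x := x, s := t }, hom := 𝟙 y },
        ⟨{ h := 𝟙 z, g := 𝟙 x, w := by simp }⟩⟩

end Grothendieck

instance (G : BisetRf.{u}) : IsIso (grothendieckLax.mapId G) :=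
  Grothendieck.isIso_unitTriple G.gpd

instance {K H G : BisetRf.{u}} (S : K ⟶ H) (T : H ⟶ G) : IsIso (grothendieckLax.mapComp S T) :=
  Grothendieck.isIso_compTriple S T

/-- The Grothendieck construction pseudo-functor. -/
noncomputable def grothendieck : Pseudofunctor BisetRf.{u} SpanRf.{u} :=
  Pseudofunctor.mkOfLax' grothendieckLax

/-- Passing from the lax functor to the pseudo-functor only adds inverses of the structure 2-cells,
so the prescribed data are kept on the nose. -/
lemma grothendieck_toLax : grothendieck.{u}.toLax = grothendieckLax := rfl

/-! ### The comparison from the realization of `∫ S` to `S` -/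

namespace Grothendieck

open RfBiset Realization

variable {K H G : FinGpd.{u}}

/-- The pair `(h, g⁻¹)` is a morphism of `∫ S` from `(y', x', g · s · h)` to `(y, x, s)`, and
sliding it across the tensor product relates the two classes. This makes `s ↦ [1, 1]` both
equivariant and inverse to evaluation. -/
lemma elt_span_act (S : RfBiset H G) {y y' : H} {x x' : G} (h : y' ⟶ y) (g : x ⟶ x')
    (s : S.El y x) :
    elt (span S) { y := y', x := x', s := S.act h g s } (𝟙 x') (𝟙 y') =
      elt (span S) { y := y, x := x, s := s } g h := by
  have e := elt_map (span S) (x := x') (y := y') (z := { y := y', x := x', s := S.act h g s })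
    (z' := { y := y, x := x, s := s }) { h := h, g := inv g, w := by simp } g (𝟙 y')
  simpa using e

/-- The comparison `[g, h] ↦ g · s · h` at `(y, x, s)`, from the realization of `∫ S` to `S`. -/
def realSpan (S : RfBiset H G) : real (span S) ≅ S where
  hom := realDesc (X := span S) (U := S) (fun z g h => S.act h g z.s)
    (fun {y x z z'} p g h => by
      -- Balancedness is the defining equation of the morphism `p` of `∫ S`, acted on by `h` and
      -- `g`.
      have e := congrArg (S.act h g) p.w
      simpa using e)
    (fun b a z g h => by simp)
  inv := mkHom (fun {y x} s => elt (span S) { y := y, x := x, s := s } (𝟙 x) (𝟙 y))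
    (fun h g s => by rw [elt_span_act, elt_act]; simp)
  hom_inv_id := real_ext (fun y x z g h => elt_span_act S h g z.s)
  inv_hom_id := hom_ext (fun y x s => S.act_id s)

lemma realSpan_naturality {S T : RfBiset H G} (φ : S ⟶ T) :
    Realization.map₂ (triple φ).toHom ≫ (realSpan T).hom = (realSpan S).hom ≫ φ :=
  real_ext (fun y x z g h => by
    change T.act (h ≫ 𝟙 _) (𝟙 _ ≫ g) (app φ z.s) = app φ (S.act h g z.s)
    simp [app_act])

lemma realSpan_id (G : FinGpd.{u}) :
    (Realization.mapId G).inv ≫ Realization.map₂ (unitTriple G).toHom ≫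
      (realSpan (RfBiset.id G)).hom = 𝟙 (RfBiset.id G) :=
  hom_ext (fun y x (s : y ⟶ x) => by
    change (𝟙 y ≫ 𝟙 y) ≫ 𝟙 y ≫ 𝟙 y ≫ s = s
    simp)

/-- On `[[g, k], [m, h]]`, with `s` and `t` the elements carried by `p` and `q`, one side gives `[g
· t · (k m), s · h]` and the other `[g · t · k, m · s · h]`. They differ by moving `m` across the
tensor product. -/
lemma realSpan_comp (S : RfBiset K H) (T : RfBiset H G) :
    (Realization.mapComp (span S) (span T)).inv ≫ Realization.map₂ (compTriple S T).toHom ≫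
        (realSpan (comp S T)).hom =
      BisetRf.whiskerL (real (span S)) (realSpan T).hom ≫ BisetRf.whiskerR (realSpan S).hom T :=
  comp_real_ext (fun z x y q g k p m h => by
    change tmk (S := S) (T := T) (T.act (𝟙 _) (𝟙 _ ≫ g) (T.act (m ≫ k) (𝟙 _) q.s))
        (S.act (h ≫ 𝟙 _) (𝟙 _) p.s) =
      tmk (S := S) (T := T) (T.act k g q.s) (S.act h m p.s)
    have e := tmk_act (S := S) (T := T) m (T.act k g q.s) (S.act h (𝟙 _) p.s)
    simpa using e)

/-! ### The comparison from a span to `∫` of its realization -/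

/-- The comparison from a span `X` to `∫` of its realization, sending `z` to `(l z, r z, [1, 1])`. -/
@[reducible]
def unitSpan (X : RfSpan H G) : SpanTriple X (span (real X)) where
  p :=
    { obj := fun z => { y := X.l.obj z, x := X.r.obj z, s := elt X z (𝟙 _) (𝟙 _) }
      map := fun {z w} f =>
        { h := X.l.map f
          g := X.r.map f
          w := by
            rw [elt_act, elt_act]
            simpa using elt_map X f (𝟙 _) (𝟙 _) }
      map_id := fun z => Hom.ext (X.l.map_id z) (X.r.map_id z)
      map_comp := fun f g => Hom.ext (X.l.map_comp f g) (X.r.map_comp f g) }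
  α := fun z => 𝟙 (X.l.obj z)
  α_nat := by simp
  β := fun z => 𝟙 (X.r.obj z)
  β_nat := by simp

/-- A single morphism suffices, with no zigzag, because the apex is a groupoid. This is what turns
morphisms of `∫` of a realization back into morphisms of the apex. -/
lemma elt_eq_iff (X : RfSpan H G) {y : H} {x : G} {z z' : X.apex} {g : X.r.obj z ⟶ x}
    {h : y ⟶ X.l.obj z} {g' : X.r.obj z' ⟶ x} {h' : y ⟶ X.l.obj z'} :
    elt X z g h = elt X z' g' h' ↔ ∃ p : z ⟶ z', g = X.r.map p ≫ g' ∧ h ≫ X.l.map p = h' := by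
  refine tmk_eq_iff.trans (exists_congr fun p => ?_)
  simp [lower_act, upper_act]

/-- A morphism `(h, g)` between the images of `z` and `w` is an equality `[g, 1] = [1, h]`, which
produces `p : z ⟶ w` with `r p = g` and `l p = h`. An object `(y, x, [g, h])` with representative at
`z` is reached from the image of `z` by `(h⁻¹, g)`. -/
lemma isIso_unitSpan (X : RfSpan H G) : IsIso (unitSpan X).toHom := by
  refine SpanTriple.isIso_toHom _ (fun {z w} k => ?_) (fun w => ?_)
  · have e := k.w
    dsimp only at e
    rw [elt_act, elt_act, elt_eq_iff] at e
    obtain ⟨p, h₁, h₂⟩ := e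
    simp only [Category.comp_id, Category.id_comp] at h₁ h₂
    exact ⟨p, Hom.ext h₂ h₁.symm⟩
  · obtain ⟨y, x, a⟩ := w
    induction a using elt_ind with
    | h z g h =>
      exact ⟨z, ⟨{ h := inv h, g := g, w := by rw [elt_act, elt_act]; simp }⟩⟩

lemma unitSpan_naturality {X Y : RfSpan H G} (t : X ⟶ Y) :
    t ≫ (unitSpan Y).toHom = (unitSpan X).toHom ≫ (triple (Realization.map₂ t)).toHom := by
  obtain ⟨t⟩ := t
  -- The two functors differ on objects: `z` goes to the class `[1, 1]` at `p z` on one side and to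
  -- `[β, α]` at `p z` on the other. The pair `(α⁻¹, β)` connects them.
  refine SpanTriple.sound (fun z => { h := inv (t.α z), g := t.β z, w := ?_ })
    (fun z => ?_) (fun z => ?_)
  · change (real Y).act _ _ (elt Y _ _ _) = (real Y).act _ _ (elt Y _ (t.β z ≫ 𝟙 _) (𝟙 _ ≫ t.α z))
    rw [elt_act, elt_act]
    simp
  · simp
  · simp

lemma unitSpan_id (G : FinGpd.{u}) :
    (unitSpan (RfSpan.id G)).toHom =
      (unitTriple G).toHom ≫ (triple (Realization.mapId G).inv).toHom :=
  SpanTriple.sound (fun z => { h := 𝟙 z, g := 𝟙 z, w := rfl }) (fun z => by simp)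
    (fun z => by simp)

lemma unitSpan_comp (X : RfSpan K H) (Y : RfSpan H G) :
    (unitSpan (X.comp Y)).toHom =
      SpanRf.whiskerL X (unitSpan Y).toHom ≫
        SpanRf.whiskerR (unitSpan X).toHom (span (real Y)) ≫
          (compTriple (real X) (real Y)).toHom ≫ (triple (Realization.mapComp X Y).inv).toHom :=
  SpanTriple.sound (fun z => {
      h := 𝟙 (X.l.obj z.left)
      g := 𝟙 (Y.r.obj z.right)
      w := by
        refine (act_id _ _).trans (Eq.trans ?_ (act_id _ _).symm)
        -- At `(p, q, θ)` the composite pairs `[1, θ]` at `q` with `[1, 1]` at `p`, and the result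
        -- is `[1, 1]` at `(p, q, θ)`. The isomorphism recovered agrees with `θ` only up to identity
        -- factors, hence the final congruence.
        change elt (X.comp Y) z (𝟙 _) (𝟙 _) =
          pairing X Y ((real Y).act ((𝟙 _) ≫ z.hom ≫ 𝟙 _) (𝟙 _) (elt Y z.right (𝟙 _) (𝟙 _)))
            (elt X z.left (𝟙 _) (𝟙 _))
        rw [elt_act, pairing_elt, Category.comp_id (𝟙 (Y.r.obj z.right))]
        exact elt_congr X Y (a := z.hom) (by simp) (𝟙 _) (𝟙 _) })
    (fun z => by simp) (fun z => by simp)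

end Grothendieck

/-! ### The two icons and the biequivalence -/

open CategoryTheory.Bicategory

/-- The icon from `ℛ ∘ ∫` to the identity, with components `realSpan`. -/
noncomputable def realizationGrothendieckIcon :
    PseudoOver.Icon (o := fun G : BisetRf.{u} => G) (PseudoOver.of (grothendieck.comp realization))
      (PseudoOver.of (Pseudofunctor.id BisetRf.{u})) where
  iso S := Grothendieck.realSpan S
  naturality φ := Grothendieck.realSpan_naturality φ
  -- The structure 2-cells of a composite pseudo-functor are themselves composites, and those of the
  -- identity are identities. Only bracketing and a trailing identity separate these laws from the
  -- lemmas on `realSpan`.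
  map_id G := (Category.assoc _ _ _).trans (Grothendieck.realSpan_id G.gpd)
  map_comp S T := (Category.assoc _ _ _).trans ((Grothendieck.realSpan_comp S T).trans
    (congrArg (BisetRf.whiskerL (Realization.real (Grothendieck.span S))
      (Grothendieck.realSpan T).hom ≫ ·) (Category.comp_id _).symm))

/-- The icon from the identity to `∫ ∘ ℛ`, with components `unitSpan`. -/
noncomputable def grothendieckRealizationIcon :
    PseudoOver.Icon (o := fun G : SpanRf.{u} => G) (PseudoOver.of (Pseudofunctor.id SpanRf.{u}))
      (PseudoOver.of (realization.comp grothendieck)) where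
  iso X := @asIso _ _ _ _ (Grothendieck.unitSpan X).toHom (Grothendieck.isIso_unitSpan X)
  naturality φ := Grothendieck.unitSpan_naturality φ
  map_id G := (Category.id_comp _).trans (Grothendieck.unitSpan_id G.gpd)
  map_comp X Y := (Category.id_comp _).trans (Grothendieck.unitSpan_comp X Y)

/-- The equality with `grothendieckLax` pins the structure 2-cells of `∫` to the prescribed ones.
One icon starts at the identity, so it is inverted to give an equivalence in the stated direction.
-/
theorem theoremB8 :
    (∀ G : SpanRf.{u}, (realization.obj G).gpd = G.gpd) ∧
    ∃ I : Pseudofunctor BisetRf.{u} SpanRf.{u},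
      I.toLax = grothendieckLax ∧
      (∀ G : BisetRf.{u}, (I.obj G).gpd = G.gpd) ∧
      Nonempty (Bicategory.Equivalence (realization.comp I) (Pseudofunctor.id SpanRf.{u})) ∧
      Nonempty (Bicategory.Equivalence (I.comp realization) (Pseudofunctor.id BisetRf.{u})) :=
  ⟨fun _ => rfl, grothendieck, grothendieck_toLax, fun _ => rfl,
    ⟨grothendieckRealizationIcon.symm.equivalence⟩, ⟨realizationGrothendieckIcon.equivalence⟩⟩
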